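/- Let $d\ge 1$. Let $\Omega\subset\mathbb R^d$ be an open set immersed in a finite mesh $\mathcal T$ of closed hypercubes of side $h>0$ taken from a uniform axis-aligned grid: $\Omega\subset\Omega_{\mathcal T}:=\bigcup_{T\in\mathcal T}T$, and $T\cap\Omega\ne\emptyset$ for all $T\in\mathcal T$. Let $\mathcal T_\Gamma=\{T\in\mathcal T: T\cap\partial\Omega\neq\emptyset\}$ be the set of cut elements, and let $\mathcal F_\Gamma$ be the set of common $(d-1)$-dimensional faces of two elements of $\mathcal T$ at least one of which is in $\mathcal T_\Gamma$. For $p\ge1$ let $V_h^p$ be the space of continuous functions on $\Omega_{\mathcal T}$ whose restriction to every $T\in\mathcal T$ is a polynomial of degree at most $p$ in each variable. For weights $w_1,\dots,w_p>0$ and a penalty parameter $\gamma_M>0$ let $$M(u,v)=(u,v)_{L^2(\Omega)}+\gamma_M\sum_{F\in\mathcal F_\Gamma}\sum_{k=1}^p w_k\frac{h^{2k+1}}{(2k+1)(k!)^2}\int_F[\partial_n^ku][\partial_n^kv],$$ where $[\cdot]$ denotes the jump over $F$ and $\partial_n^k$ the $k$-th derivative in the direction of the face normal. For a basis $(\phi_i)$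 of $V_h^p$ (for example the Lagrange basis with Gauss–Lobatto nodes) let $\mathcal M_{ij}=M(\phi_i,\phi_j)$ be the stabilized mass matrix and $\mathcal M^*_{ij}=(\phi_i,\phi_j)_{L^2(\Omega_{\mathcal T})}$ the mass matrix on the background mesh. Let $\kappa(A)=\|A\|_2\|A^{-1}\|_2$ denote the spectral condition number (for a symmetric positive definite matrix, $\lambda_{\max}/\lambda_{\min}$). Suppose that the geometry is resolved by the mesh in the sense that, for an integer $N_J\ge 0$, from every cut element one can reach an element of $\mathcal T\setminus\mathcal T_\Gamma$ by at most $N_J$ jumps, each from a cut element to an element of $\mathcal T$ that shares a face with it. Let $C_1(p)$ be a constant, depending only on $p$ and $d$, such that $\|q\|_{L^2(T_1)}^2\le C_1(p)\|q\|_{L^2(T_2)}^2$ for all grid cells $T_1,T_2$ (of any size) that share a face and all polynomials $q$ of degree at most $p$ in each variable; such a constant exists. Put $$L(w)=C_1(p)+\sum_{k=1}^p\frac1{w_k},\qquad G(w)=\sum_{k=1}^p w_k\frac{p^{4k+2}}{(2k+1)(k!)^2}.$$ Then $\mathcal M$ and $\mathcal M^*$ are positive definite and $$\kappa(\mathcal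 M)\le C_M(w)\,\kappa(\mathcal M^*),\qquad C_M(w)=C_l\,L(w)^{N_J}\,(1+C_g\,G(w)),$$ where the constant $C_g>0$ depends only on $d$ and $\gamma_M$, and the constant $C_l>0$ only on $d$, $\gamma_M$ and $N_J$. In particular neither depends on $h$, $p$, $w$, the choice of basis, or on how the boundary of $\Omega$ cuts the mesh. -/

import Mathlib

open MeasureTheory

noncomputable section

namespace CutFEM

/-- The closed grid cell with multi-index `c` of the axis-aligned grid of mesh size `h` through the
point `o`: the hypercube `∏ᵢ [oᵢ + h cᵢ, oᵢ + h (cᵢ + 1)]`. -/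
def gridCell {d : ℕ} (o : Fin d → ℝ) (h : ℝ) (c : Fin d → ℤ) : Set (Fin d → ℝ) :=
  {x | ∀ i, o i + h * (c i : ℝ) ≤ x i ∧ x i ≤ o i + h * ((c i : ℝ) + 1)}

/-- The multi-index of the neighbour of the cell `c` in the positive `j`-th direction. -/
def nextCell {d : ℕ} (c : Fin d → ℤ) (j : Fin d) : Fin d → ℤ :=
  Function.update c j (c j + 1)

/-- Two cells share a `(d-1)`-dimensional face. -/
def ShareFace {d : ℕ} (c c' : Fin d → ℤ) : Prop :=
  ∃ j, c' = nextCell c j ∨ c = nextCell c' j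

/-- An open set `Ω ⊆ ℝ^d` immersed in a (finite) mesh of hypercubes of side `h`, aligned with the
coordinate axes: the cells cover `Ω`, and every cell has some part inside `Ω`. -/
structure ImmersedDomain (d : ℕ) where
  /-- a grid point -/
  o : Fin d → ℝ
  /-- the mesh size -/
  h : ℝ
  h_pos : 0 < h
  /-- the multi-indices of the elements of the mesh -/
  cells : Finset (Fin d → ℤ)
  /-- the domain -/
  Ω : Set (Fin d → ℝ)
  isOpen_Ω : IsOpen Ω
  Ω_subset : Ω ⊆ ⋃ c ∈ cells, gridCell o h c
  cell_inter_Ω : ∀ c ∈ cells, (gridCell o h c ∩ Ω).Nonempty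

namespace ImmersedDomain

variable {d : ℕ} (D : ImmersedDomain d)

/-- The element with multi-index `c`. -/
def cell (c : Fin d → ℤ) : Set (Fin d → ℝ) := gridCell D.o D.h c

/-- The domain `Ω_𝒯` covered by the mesh. -/
def meshDomain : Set (Fin d → ℝ) := ⋃ c ∈ D.cells, D.cell c

open Classical in
/-- The cut elements `𝒯_Γ`: the elements intersected by the boundary of `Ω`. -/
def cutCells : Finset (Fin d → ℤ) :=
  D.cells.filter fun c => (D.cell c ∩ frontier D.Ω).Nonempty

open Classical in
/-- The stabilized faces `ℱ_Γ`. The pair `(c, j)` stands for the common face of the cells `c` and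
`nextCell c j`; both have to be elements of the mesh, and at least one of them has to be cut. -/
def cutFaces : Finset ((Fin d → ℤ) × Fin d) :=
  (D.cells ×ˢ Finset.univ).filter fun F =>
    nextCell F.1 F.2 ∈ D.cells ∧ (F.1 ∈ D.cutCells ∨ nextCell F.1 F.2 ∈ D.cutCells)

/-- From every cut element one reaches an uncut element of the mesh in at most `N` jumps, each jump
leading from a cut element to an element of the mesh sharing a face with it. -/
def ResolvedWithin (N : ℕ) : Prop :=
  ∀ c ∈ D.cutCells, ∃ n ≤ N, ∃ T : ℕ → (Fin d → ℤ),
    T 0 = c ∧ (∀ i < n, T i ∈ D.cutCells ∧ ShareFace (T i) (T (i + 1))) ∧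
      T n ∈ D.cells ∧ T n ∉ D.cutCells

/-- The continuous finite element space `V_h^p`: continuous functions on `Ω_𝒯` whose restriction to
each element is a polynomial of degree at most `p` in each variable. A function on `Ω_𝒯` is
identified with its extension by zero to `ℝ^d`. -/
def feSpace (p : ℕ) : Submodule ℝ ((Fin d → ℝ) → ℝ) where
  carrier := {v | ContinuousOn v D.meshDomain ∧ (∀ x, x ∉ D.meshDomain → v x = 0) ∧
    ∀ c ∈ D.cells, ∃ q : MvPolynomial (Fin d) ℝ, (∀ i, q.degreeOf i ≤ p) ∧
      ∀ x ∈ D.cell c, v x = MvPolynomial.eval x q}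
  zero_mem' := ⟨continuousOn_const, fun _ _ => rfl, fun _ _ => ⟨0, by simp, by simp⟩⟩
  add_mem' := by
    rintro u v ⟨hu, hu0, huq⟩ ⟨hv, hv0, hvq⟩
    refine ⟨hu.add hv, fun x hx => by simp [hu0 x hx, hv0 x hx], fun c hc => ?_⟩
    obtain ⟨q, hq, hqu⟩ := huq c hc
    obtain ⟨r, hr, hrv⟩ := hvq c hc
    refine ⟨q + r, fun i => (MvPolynomial.degreeOf_add_le i q r).trans (max_le (hq i) (hr i)),
      fun x hx => by simp [hqu x hx, hrv x hx]⟩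
  smul_mem' := by
    rintro a v ⟨hv, hv0, hvq⟩
    refine ⟨hv.const_smul a, fun x hx => by simp [hv0 x hx], fun c hc => ?_⟩
    obtain ⟨q, hq, hqv⟩ := hvq c hc
    refine ⟨MvPolynomial.C a * q,
      fun i => (MvPolynomial.degreeOf_C_mul_le q i a).trans (hq i),
      fun x hx => by simp [hqv x hx]⟩

/-- The `k`-th derivative in direction `x_j` at `x` of the restriction of `v` to the element `c`
(one-sided if `x` lies on a face of the element that is orthogonal to `x_j`). -/
def cellDeriv (c : Fin d → ℤ) (j : Fin d) (k : ℕ) (v : (Fin d → ℝ) → ℝ) (x : Fin d → ℝ) : ℝ :=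
  iteratedDerivWithin k (fun t => v (Function.update x j t))
    (Set.Icc (D.o j + D.h * (c j : ℝ)) (D.o j + D.h * ((c j : ℝ) + 1))) (x j)

/-- The jump `[∂_n^k v]` over the face between `c` and `nextCell c j`, where the normal `n` is the
`j`-th unit vector. -/
def jump (c : Fin d → ℤ) (j : Fin d) (k : ℕ) (v : (Fin d → ℝ) → ℝ) (x : Fin d → ℝ) : ℝ :=
  D.cellDeriv (nextCell c j) j k v x - D.cellDeriv c j k v x

/-- The integral of `f` over the common face of `c` and `nextCell c j`, with respect to
`(d-1)`-dimensional Lebesgue measure in the coordinates `x_i`, `i ≠ j`. -/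
def faceIntegral (c : Fin d → ℤ) (j : Fin d) (f : (Fin d → ℝ) → ℝ) : ℝ :=
  ∫ y in {y : {i : Fin d // i ≠ j} → ℝ |
      ∀ i : {i : Fin d // i ≠ j}, D.o i.1 + D.h * (c i.1 : ℝ) ≤ y i ∧
        y i ≤ D.o i.1 + D.h * ((c i.1 : ℝ) + 1)},
    f (fun i => if hi : i = j then D.o j + D.h * ((c j : ℝ) + 1) else y ⟨i, hi⟩)

/-- The `L²` scalar product over `X ⊆ ℝ^d`. -/
def l2Inner (X : Set (Fin d → ℝ)) (u v : (Fin d → ℝ) → ℝ) : ℝ := ∫ x in X, u x * v x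

/-- The weighted jump stabilization `j(u, v)`. -/
def stab (p : ℕ) (w : ℕ → ℝ) (u v : (Fin d → ℝ) → ℝ) : ℝ :=
  ∑ F ∈ D.cutFaces, ∑ k ∈ Finset.Icc 1 p,
    w k * (D.h ^ (2 * k + 1) / ((2 * k + 1) * (k.factorial : ℝ) ^ 2)) *
      D.faceIntegral F.1 F.2 (fun x => D.jump F.1 F.2 k u x * D.jump F.1 F.2 k v x)

/-- The stabilized bilinear form `M(u, v) = (u, v)_Ω + γ j(u, v)`. -/
def massForm (p : ℕ) (w : ℕ → ℝ) (γ : ℝ) (u v : (Fin d → ℝ) → ℝ) : ℝ :=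
  l2Inner D.Ω u v + γ * D.stab p w u v

/-- The stabilized mass matrix `M(φ_i, φ_j)` in the basis `φ`. -/
def massMatrix {p : ℕ} {ι : Type*} (φ : Module.Basis ι ℝ (D.feSpace p)) (w : ℕ → ℝ) (γ : ℝ) :
    Matrix ι ι ℝ :=
  Matrix.of fun i j => D.massForm p w γ (φ i : (Fin d → ℝ) → ℝ) (φ j : (Fin d → ℝ) → ℝ)

/-- The mass matrix `(φ_i, φ_j)_{Ω_𝒯}` of the whole background mesh in the basis `φ`. -/
def meshMassMatrix {p : ℕ} {ι : Type*} (φ : Module.Basis ι ℝ (D.feSpace p)) : Matrix ι ι ℝ :=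
  Matrix.of fun i j =>
    l2Inner D.meshDomain (φ i : (Fin d → ℝ) → ℝ) (φ j : (Fin d → ℝ) → ℝ)

end ImmersedDomain

/-- The spectral condition number `‖A‖₂ ‖A⁻¹‖₂` of an invertible real matrix. -/
def condNumber {ι : Type*} [Fintype ι] [DecidableEq ι] (A : Matrix ι ι ℝ) : ℝ :=
  ‖Matrix.toEuclideanCLM (n := ι) (𝕜 := ℝ) A‖ * ‖Matrix.toEuclideanCLM (n := ι) (𝕜 := ℝ) A⁻¹‖

/-- `C` is a constant in the equivalence of the squared `L²` norms on two neighbouring elements, for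
polynomials of degree at most `p` in each of the `d` variables, uniformly in the mesh size. -/
def IsNeighbourConst (d p : ℕ) (C : ℝ) : Prop :=
  ∀ (o : Fin d → ℝ) (h : ℝ), 0 < h → ∀ c c' : Fin d → ℤ, ShareFace c c' →
    ∀ q : MvPolynomial (Fin d) ℝ, (∀ i, q.degreeOf i ≤ p) →
      ∫ x in gridCell o h c, (MvPolynomial.eval x q) ^ 2 ≤
        C * ∫ x in gridCell o h c', (MvPolynomial.eval x q) ^ 2

/-- `L(w) = C₁ + ∑_{k=1}^p 1 / w_k`. -/
def weightL (C₁ : ℝ) (p : ℕ) (w : ℕ → ℝ) : ℝ := C₁ + ∑ k ∈ Finset.Icc 1 p, 1 / w k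

/-- `G(w) = ∑_{k=1}^p w_k p^{4k+2} / ((2k+1) (k!)²)`. -/
def weightG (p : ℕ) (w : ℕ → ℝ) : ℝ :=
  ∑ k ∈ Finset.Icc 1 p, w k * ((p : ℝ) ^ (4 * k + 2) / ((2 * k + 1) * (k.factorial : ℝ) ^ 2))

end CutFEM

end

open MeasureTheory

noncomputable section

namespace CutFEM

/-! ### Legendre expansions and inverse inequalities for univariate polynomials -/

section Univariate

open Polynomial

/-! Both matrices represent quadratic forms on the finite element space in the same basis. It
therefore suffices to find K and β with ‖v‖² ≤ K M(v, v) and M(v, v) ≤ β ‖v‖², where the norm is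
that of L² on the whole background mesh: then κ(ℳ) ≤ K β κ(ℳ*) in every basis
(`condNumber_le_mul_condNumber`).

Bound with K (`l2Inner_meshDomain_le`). On two cells sharing a face, v coincides with polynomials P
and Q. On each line normal to the face, Taylor expansion at the face gives P = Q + ∑ [∂ₙᵏ v] tᵏ /
k!, and the term k = 0 is absent because v is continuous. A Cauchy–Schwarz inequality with weights
C₁ and 1 / w_k produces the factor L(w), and integrating t²ᵏ over the cell produces exactly the
scaling of the stabilization. What remains of Q lives on the cell of P and is moved back to its own
cell by the neighbour constant (`cellEnergy_le_of_face`). Uncut cells lie in Ω, and every other cell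
is reached in at most N_J such steps, each costing L(w) and a factor depending on d alone
(`sum_reach_le`).

Bound with β (`massForm_self_le`). The jumps are estimated by an inverse trace inequality for k-th
derivatives with constant 36 p^(4k+2). It follows from expanding a polynomial in shifted Legendre
polynomials, whose norms and coefficients are explicit (`factorial_mul_coeff_sq_le`). Summing over k
and over the faces gives G(w) with a factor depending on d alone (`stab_self_le`). -/

theorem integral_derivative_mul_eval (F G : ℝ[X]) :
    ∫ x in (0 : ℝ)..1, (derivative F).eval x * G.eval x =
      F.eval 1 * G.eval 1 - F.eval 0 * G.eval 0 -
        ∫ x in (0 : ℝ)..1, F.eval x * (derivative G).eval x := by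
  have h := intervalIntegral.integral_mul_deriv_eq_deriv_mul (a := 0) (b := 1)
    (u := fun x => F.eval x) (v := fun x => G.eval x) (u' := fun x => (derivative F).eval x)
    (v' := fun x => (derivative G).eval x)
    (fun x _ => F.hasDerivAt x) (fun x _ => G.hasDerivAt x)
    ((derivative F).continuous.intervalIntegrable _ _)
    ((derivative G).continuous.intervalIntegrable _ _)
  rw [h]; ring

theorem integral_iterate_derivative_mul_eval {n m : ℕ} (hm : m ≤ n) (G : ℝ[X]) :
    ∫ x in (0 : ℝ)..1, (derivative^[m] ((X * (1 - X) : ℝ[X]) ^ n)).eval x * G.eval x =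
      (-1) ^ m * ∫ x in (0 : ℝ)..1,
        ((X * (1 - X) : ℝ[X]) ^ n).eval x * (derivative^[m] G).eval x := by
  induction m generalizing G with
  | zero => simp
  | succ m ih =>
    -- Since m < n, differentiating m times leaves a factor X (1 - X), so the boundary terms at 0
    -- and 1 vanish.
    have hd : (X * (1 - X) : ℝ[X]) ∣ derivative^[m] ((X * (1 - X) : ℝ[X]) ^ n) :=
      (dvd_pow_self _ (Nat.sub_ne_zero_of_lt hm)).trans
        (pow_sub_dvd_iterate_derivative_of_pow_dvd m dvd_rfl)
    obtain ⟨r, hr⟩ := hd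
    rw [Function.iterate_succ_apply', integral_derivative_mul_eval, ih (by lia) (derivative G),
      Function.iterate_succ_apply]
    have h0 : (derivative^[m] ((X * (1 - X) : ℝ[X]) ^ n)).eval 0 = 0 := by simp [hr]
    have h1 : (derivative^[m] ((X * (1 - X) : ℝ[X]) ^ n)).eval 1 = 0 := by simp [hr]
    rw [h0, h1]; ring

theorem integral_pow_mul_one_sub_pow (a b : ℕ) :
    ∫ x in (0 : ℝ)..1, x ^ a * (1 - x) ^ b =
      (a.factorial : ℝ) * b.factorial / (a + b + 1).factorial := by
  induction b generalizing a with
  | zero =>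
    simp only [pow_zero, mul_one, integral_pow, Nat.factorial_zero, Nat.cast_one, add_zero,
      Nat.factorial_succ, Nat.cast_mul]
    have := Nat.factorial_ne_zero a
    field_simp
    simp
  | succ b ih =>
    have h := integral_derivative_mul_eval (X ^ (a + 1)) ((1 - X) ^ (b + 1))
    have e1 : ∀ x : ℝ, (derivative (X ^ (a + 1) : ℝ[X])).eval x * ((1 - X) ^ (b + 1) : ℝ[X]).eval x
        = (a + 1) * (x ^ a * (1 - x) ^ (b + 1)) := fun x => by simp; ring
    have e2 : ∀ x : ℝ, (X ^ (a + 1) : ℝ[X]).eval x * (derivative ((1 - X) ^ (b + 1) : ℝ[X])).eval x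
        = (-(b + 1)) * (x ^ (a + 1) * (1 - x) ^ b) := fun x => by
      simp [derivative_pow]; ring
    simp only [e1, e2, intervalIntegral.integral_const_mul, ih] at h
    have h3 : (a + 1 + b + 1) = a + (b + 1) + 1 := by ring
    rw [h3] at h
    have ha : (a + 1 : ℝ) ≠ 0 := by positivity
    apply mul_left_cancel₀ ha
    rw [h]
    simp [Nat.factorial_succ]
    ring

/-- The shifted Legendre polynomial with real coefficients. -/
def legendre (n : ℕ) : ℝ[X] := (shiftedLegendre n).map (Int.castRingHom ℝ)

theorem coeff_legendre (n k : ℕ) :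
    (legendre n).coeff k = (-1) ^ k * n.choose k * (n + k).choose n := by
  simp [legendre, coeff_map, coeff_shiftedLegendre]

theorem natDegree_legendre_le {n : ℕ} : (legendre n).natDegree ≤ n :=
  natDegree_map_le.trans (natDegree_shiftedLegendre n).le

theorem factorial_mul_legendre (n : ℕ) :
    C (n.factorial : ℝ) * legendre n = derivative^[n] ((X * (1 - X) : ℝ[X]) ^ n) := by
  have h := congrArg (Polynomial.map (Int.castRingHom ℝ)) (factorial_mul_shiftedLegendre_eq n)
  rw [← mul_pow, Polynomial.map_mul, ← iterate_derivative_map] at h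
  simpa [legendre] using h

theorem factorial_mul_integral_legendre_mul (n : ℕ) (G : ℝ[X]) :
    (n.factorial : ℝ) * ∫ x in (0 : ℝ)..1, (legendre n).eval x * G.eval x =
      (-1) ^ n * ∫ x in (0 : ℝ)..1,
        ((X * (1 - X) : ℝ[X]) ^ n).eval x * (derivative^[n] G).eval x := by
  rw [← integral_iterate_derivative_mul_eval le_rfl, ← factorial_mul_legendre,
    ← intervalIntegral.integral_const_mul]
  simp [mul_assoc]

/-- By Rodrigues' formula, n integrations by parts put n derivatives on `G`, which kill it. -/
theorem integral_legendre_mul_eq_zero {n : ℕ} {G : ℝ[X]} (hG : G.degree < n) :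
    ∫ x in (0 : ℝ)..1, (legendre n).eval x * G.eval x = 0 := by
  have h := factorial_mul_integral_legendre_mul n G
  have h0 : derivative^[n] G = 0 := by
    by_cases hG0 : G = 0
    · simp [hG0]
    · exact iterate_derivative_eq_zero ((natDegree_lt_iff_degree_lt hG0).2 hG)
  have hn : (n.factorial : ℝ) ≠ 0 := by positivity
  simpa [h0, hn] using h

theorem integral_legendre_sq (n : ℕ) :
    ∫ x in (0 : ℝ)..1, (legendre n).eval x * (legendre n).eval x = 1 / (2 * n + 1) := by
  have h := factorial_mul_integral_legendre_mul n (legendre n)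
  -- Only n! times the leading coefficient survives n derivatives; what is left to integrate is a
  -- Beta integral.
  have hD : derivative^[n] (legendre n) = C ((-1) ^ n * ((n.factorial : ℝ) * (2 * n).choose n)) := by
    rw [eq_C_of_natDegree_eq_zero (p := derivative^[n] (legendre n))
      (Nat.le_zero.1 ((natDegree_iterate_derivative _ _).trans
        (by have := natDegree_legendre_le (n := n); lia)))]
    rw [coeff_iterate_derivative, coeff_legendre]
    simp [Nat.descFactorial_self, two_mul]
    ring
  have hn : (n.factorial : ℝ) ≠ 0 := by positivity
  have e : ∀ x : ℝ, ((X * (1 - X) : ℝ[X]) ^ n).eval x *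
      (C ((-1) ^ n * ((n.factorial : ℝ) * (2 * n).choose n))).eval x =
      ((-1) ^ n * ((n.factorial : ℝ) * (2 * n).choose n)) * (x ^ n * (1 - x) ^ n) := fun x => by
    simp [mul_pow]; ring
  rw [hD] at h
  simp only [e, intervalIntegral.integral_const_mul, integral_pow_mul_one_sub_pow] at h
  apply mul_left_cancel₀ hn
  rw [h, ← mul_assoc, ← mul_assoc, ← mul_pow]
  have hc : ((2 * n).choose n : ℝ) * n.factorial * n.factorial = (2 * n).factorial := by
    have := Nat.choose_mul_factorial_mul_factorial (n := 2 * n) (k := n) (by lia)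
    rw [show 2 * n - n = n by lia] at this
    exact_mod_cast this
  have h2 : ((n + n + 1).factorial : ℝ) = (2 * n + 1) * (2 * n).factorial := by
    rw [← two_mul, Nat.factorial_succ]; push_cast; ring
  rw [h2]
  have : ((2 * n).factorial : ℝ) ≠ 0 := by positivity
  rw [← hc] at this ⊢
  field_simp
  simp [(Nat.choose_pos (show n ≤ 2 * n by lia)).ne']

/-- The induction step of Cauchy–Schwarz: it adds one product to a scalar product `s` whose two
squared lengths are bounded by `K` and `I`. -/
theorem add_mul_sq_le {u v s K I : ℝ} (hK : 0 ≤ K) (hI : 0 ≤ I) (h : s ^ 2 ≤ K * I) :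
    (u * v + s) ^ 2 ≤ (u ^ 2 + K) * (v ^ 2 + I) := by
  have h1 : |2 * (u * v * s)| ≤ u ^ 2 * I + K * v ^ 2 := by
    apply abs_le_of_sq_le_sq _ (by positivity)
    nlinarith [sq_nonneg (u ^ 2 * I - K * v ^ 2), mul_le_mul_of_nonneg_left h (sq_nonneg (u * v))]
  nlinarith [le_abs_self (2 * (u * v * s))]

/-- For q = ∑ aₙ Lₙ the squared norm is ∑ aₙ² / (2n + 1) by orthogonality, while the k-th
coefficient is ∑ aₙ times that of Lₙ; Cauchy–Schwarz compares the two. The induction splits off the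
component of highest degree. -/
theorem coeff_sq_le_integral (p k : ℕ) (q : ℝ[X]) (hq : q.degree < p) :
    q.coeff k ^ 2 ≤ (∑ n ∈ Finset.range p, (2 * n + 1) * (legendre n).coeff k ^ 2) *
      ∫ x in (0 : ℝ)..1, q.eval x ^ 2 := by
  induction p generalizing q with
  | zero =>
    have : q = 0 := by
      rw [degree_lt_iff_coeff_zero] at hq
      ext m; simp [hq m (Nat.zero_le m)]
    simp [this]
  | succ p ih =>
    have hc : (legendre p).coeff p ≠ 0 := by
      rw [coeff_legendre]
      have := (Nat.choose_pos (show p ≤ p + p by lia)).ne'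
      simp [this]
    set a := q.coeff p / (legendre p).coeff p with ha
    set r := q - C a * legendre p with hr
    have hrd : r.degree < p := by
      rw [degree_lt_iff_coeff_zero] at hq ⊢
      intro m hm
      rcases hm.eq_or_lt with rfl | hm
      · simp [hr, ha, hc]
      · simp [hr, hq m hm, coeff_eq_zero_of_natDegree_lt (natDegree_legendre_le.trans_lt hm)]
    have hqr : q = C a * legendre p + r := by rw [hr]; ring
    have hint : ∫ x in (0 : ℝ)..1, q.eval x ^ 2 =
        a ^ 2 / (2 * p + 1) + ∫ x in (0 : ℝ)..1, r.eval x ^ 2 := by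
      have e : ∀ x : ℝ, q.eval x ^ 2 = a ^ 2 * ((legendre p).eval x * (legendre p).eval x) +
          2 * a * ((legendre p).eval x * r.eval x) + r.eval x ^ 2 := fun x => by
        rw [hqr]; simp; ring
      have c1 : Continuous fun x => (legendre p).eval x := (legendre p).continuous
      have c2 : Continuous fun x => r.eval x := r.continuous
      simp only [e]
      rw [intervalIntegral.integral_add, intervalIntegral.integral_add,
        intervalIntegral.integral_const_mul, intervalIntegral.integral_const_mul,
        integral_legendre_sq, integral_legendre_mul_eq_zero hrd]
      · ring
      all_goals exact Continuous.intervalIntegrable (by fun_prop) _ _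
    have hI : 0 ≤ ∫ x in (0 : ℝ)..1, r.eval x ^ 2 :=
      intervalIntegral.integral_nonneg zero_le_one fun x _ => sq_nonneg _
    have hp : (0 : ℝ) < 2 * p + 1 := by positivity
    have hs : Real.sqrt (2 * p + 1) ^ 2 = 2 * p + 1 := Real.sq_sqrt hp.le
    have hs0 : Real.sqrt (2 * p + 1) ≠ 0 := (Real.sqrt_pos.2 hp).ne'
    -- The factor √(2p + 1) is distributed so that u² is the new summand of the constant and v² the
    -- norm of the component split off.
    have key := add_mul_sq_le (u := Real.sqrt (2 * p + 1) * (legendre p).coeff k)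
      (v := a / Real.sqrt (2 * p + 1))
      (Finset.sum_nonneg fun n _ => by positivity) hI (ih r hrd)
    rw [hint, Finset.sum_range_succ, add_comm (Finset.sum _ _)]
    have e1 : q.coeff k = Real.sqrt (2 * p + 1) * (legendre p).coeff k *
        (a / Real.sqrt (2 * p + 1)) + r.coeff k := by
      rw [hqr]; field_simp; simp; ring
    rw [e1]
    refine key.trans (le_of_eq ?_)
    rw [mul_pow, div_pow, hs]

/-- The left side is k! times the absolute value of the k-th coefficient of `legendre n`. After
enlarging the second binomial by k!, it becomes a product of the factors (n - i)(n + 1 + i), i < k,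
each at most n (n + 1). -/
theorem factorial_mul_choose_mul_choose_le {n p k : ℕ} (hn : n ≤ p) :
    k.factorial * (n.choose k * (n + k).choose n) ≤ (p * (p + 1)) ^ k := by
  have h1 : k.factorial * n.choose k = n.descFactorial k :=
    (Nat.descFactorial_eq_factorial_mul_choose n k).symm
  have key : ∀ k, n.descFactorial k * (n + 1).ascFactorial k ≤ (p * (p + 1)) ^ k := by
    intro k
    induction k with
    | zero => simp
    | succ k ih =>
      rw [Nat.descFactorial_succ, Nat.ascFactorial_succ, pow_succ]
      calc (n - k) * n.descFactorial k * ((n + 1 + k) * (n + 1).ascFactorial k)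
          = (n.descFactorial k * (n + 1).ascFactorial k) * ((n - k) * (n + 1 + k)) := by ring
        _ ≤ (p * (p + 1)) ^ k * (p * (p + 1)) := by
          refine Nat.mul_le_mul ih (le_trans ?_ (Nat.mul_le_mul hn (by lia : n + 1 ≤ p + 1)))
          rcases le_total n k with h | h
          · simp [Nat.sub_eq_zero_of_le h]
          · obtain ⟨m, rfl⟩ := Nat.exists_eq_add_of_le h
            rw [Nat.add_sub_cancel_left]
            nlinarith
  have h2 : (n + k).choose n ≤ (n + 1).ascFactorial k := by
    rw [Nat.ascFactorial_eq_factorial_mul_choose, Nat.choose_symm_add]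
    exact Nat.le_mul_of_pos_left _ (Nat.factorial_pos k)
  calc k.factorial * (n.choose k * (n + k).choose n)
      = n.descFactorial k * (n + k).choose n := by rw [← mul_assoc, h1]
    _ ≤ n.descFactorial k * (n + 1).ascFactorial k := Nat.mul_le_mul_left _ h2
    _ ≤ _ := key k

/-- The quotient of the two powers is (1 + 1/p)ᵏ ≤ (1 + 1/p)ᵖ ≤ e < 3, so the constant is
independent of p. -/
theorem mul_succ_pow_le {p k : ℕ} (hp : 1 ≤ p) (hk : k ≤ p) :
    ((p : ℝ) * (p + 1)) ^ k ≤ 3 * (p : ℝ) ^ (2 * k) := by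
  have hp0 : (0 : ℝ) < p := by exact_mod_cast hp
  have e : (p : ℝ) * (p + 1) = p ^ 2 * (1 / p + 1) := by field_simp; ring
  rw [e, mul_pow, ← pow_mul, mul_comm]
  refine mul_le_mul_of_nonneg_right ?_ (by positivity)
  calc (1 / (p : ℝ) + 1) ^ k ≤ (1 / (p : ℝ) + 1) ^ p :=
        pow_le_pow_right₀ (by simp) hk
    _ ≤ Real.exp (1 / p) ^ p := pow_le_pow_left₀ (by positivity) (Real.add_one_le_exp _) _
    _ = Real.exp 1 := by rw [← Real.exp_nat_mul]; congr 1; field_simp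
    _ ≤ 3 := by linarith [Real.exp_one_lt_d9]

/-- An inverse trace inequality on [0, 1], as k! times the coefficient is the k-th derivative at 0.
The constant is 36 = 3² · 2²: the 3 bounds the Legendre coefficients, and ∑ (2n + 1) = (p + 1)² ≤
(2p)². -/
theorem factorial_mul_coeff_sq_le {p k : ℕ} (hp : 1 ≤ p) (hk : k ≤ p) (q : ℝ[X])
    (hq : q.natDegree ≤ p) :
    ((k.factorial : ℝ) * q.coeff k) ^ 2 ≤ 36 * (p : ℝ) ^ (4 * k + 2) *
      ∫ x in (0 : ℝ)..1, q.eval x ^ 2 := by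
  have h := coeff_sq_le_integral (p + 1) k q
    (lt_of_le_of_lt (degree_le_of_natDegree_le hq) (by exact_mod_cast Nat.lt_succ_self p))
  have hI : 0 ≤ ∫ x in (0 : ℝ)..1, q.eval x ^ 2 :=
    intervalIntegral.integral_nonneg zero_le_one fun x _ => sq_nonneg _
  rw [mul_pow]
  refine (mul_le_mul_of_nonneg_left h (sq_nonneg _)).trans ?_
  rw [← mul_assoc]
  refine mul_le_mul_of_nonneg_right ?_ hI
  have hp1 : (1 : ℝ) ≤ p := by exact_mod_cast hp
  have hsum : ∑ n ∈ Finset.range (p + 1), (2 * (n : ℝ) + 1) = (p + 1) ^ 2 := by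
    clear * -
    induction p with
    | zero => simp
    | succ p ih => rw [Finset.sum_range_succ, ih]; push_cast; ring
  rw [Finset.mul_sum]
  calc ∑ n ∈ Finset.range (p + 1),
        (k.factorial : ℝ) ^ 2 * ((2 * n + 1) * (legendre n).coeff k ^ 2)
      ≤ ∑ n ∈ Finset.range (p + 1), (2 * (n : ℝ) + 1) * (3 * (p : ℝ) ^ (2 * k)) ^ 2 := by
        refine Finset.sum_le_sum fun n hn => ?_
        have hn' : n ≤ p := by simpa [Nat.lt_succ_iff] using hn
        have h1 : (k.factorial : ℝ) * (n.choose k * (n + k).choose n) ≤ 3 * (p : ℝ) ^ (2 * k) :=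
          le_trans (by exact_mod_cast factorial_mul_choose_mul_choose_le (k := k) hn')
            (mul_succ_pow_le hp hk)
        have h2 := pow_le_pow_left₀ (by positivity) h1 2
        have h3 : ((-1 : ℝ) ^ k) ^ 2 = 1 := by rw [← pow_mul, mul_comm, pow_mul]; simp
        calc _ = (2 * (n : ℝ) + 1) * ((k.factorial : ℝ) * (n.choose k * (n + k).choose n)) ^ 2 := by
              rw [coeff_legendre, mul_pow, mul_pow, h3]; ring
          _ ≤ _ := mul_le_mul_of_nonneg_left h2 (by positivity)
    _ = 9 * (p : ℝ) ^ (4 * k) * (p + 1) ^ 2 := by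
        rw [← Finset.sum_mul, hsum]; ring
    _ ≤ 9 * (p : ℝ) ^ (4 * k) * (2 * p) ^ 2 := by gcongr; linarith
    _ = 36 * (p : ℝ) ^ (4 * k + 2) := by ring

/-- The polynomial `s ↦ P (a + b s)`. -/
def affineComp (P : ℝ[X]) (a b : ℝ) : ℝ[X] := P.comp (C b * X + C a)

theorem eval_affineComp (P : ℝ[X]) (a b s : ℝ) :
    (affineComp P a b).eval s = P.eval (a + b * s) := by
  simp [affineComp, add_comm]

theorem natDegree_affineComp_le (P : ℝ[X]) (a b : ℝ) :
    (affineComp P a b).natDegree ≤ P.natDegree := by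
  refine natDegree_comp_le.trans ?_
  exact (Nat.mul_le_mul_left _ natDegree_linear_le).trans (by simp)

theorem iterate_derivative_affineComp (P : ℝ[X]) (a b : ℝ) (k : ℕ) :
    derivative^[k] (affineComp P a b) = C (b ^ k) * affineComp (derivative^[k] P) a b := by
  induction k with
  | zero => simp
  | succ k ih =>
    rw [Function.iterate_succ_apply', ih, Function.iterate_succ_apply' _ k P]
    rw [derivative_C_mul]
    simp [affineComp, derivative_comp, pow_succ]
    ring

theorem factorial_mul_coeff_affineComp (P : ℝ[X]) (a b : ℝ) (k : ℕ) :
    (k.factorial : ℝ) * (affineComp P a b).coeff k = b ^ k * (derivative^[k] P).eval a := by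
  have h : (derivative^[k] (affineComp P a b)).coeff 0 =
      (k.factorial : ℝ) * (affineComp P a b).coeff k := by
    simp [coeff_iterate_derivative, Nat.descFactorial_self]
  rw [← h, coeff_zero_eq_eval_zero, iterate_derivative_affineComp]
  simp [eval_affineComp]

/-- Inverse trace inequality for the `k`-th derivative. -/
theorem sq_iterate_derivative_le_integral {p k : ℕ} (hp : 1 ≤ p) (hk : k ≤ p) (P : ℝ[X])
    (hP : P.natDegree ≤ p) (a b : ℝ) :
    b ^ (2 * k) * (derivative^[k] P).eval a ^ 2 ≤ 36 * (p : ℝ) ^ (4 * k + 2) *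
      ∫ s in (0 : ℝ)..1, P.eval (a + b * s) ^ 2 := by
  have h := factorial_mul_coeff_sq_le hp hk (affineComp P a b)
    ((natDegree_affineComp_le P a b).trans hP)
  simp only [eval_affineComp, factorial_mul_coeff_affineComp] at h
  rw [mul_pow, ← pow_mul, mul_comm k 2] at h
  exact h

theorem eval_add_mul_eq_sum {p : ℕ} (P : ℝ[X]) (hP : P.natDegree ≤ p) (a b s : ℝ) :
    P.eval (a + b * s) = ∑ k ∈ Finset.range (p + 1),
      (derivative^[k] P).eval a * ((b * s) ^ k / k.factorial) := by
  rw [← eval_affineComp, eval_eq_sum_range' (n := p + 1)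
    (Nat.lt_succ_of_le ((natDegree_affineComp_le P a b).trans hP))]
  refine Finset.sum_congr rfl fun k _ => ?_
  have h := factorial_mul_coeff_affineComp P a b k
  have hk : (k.factorial : ℝ) ≠ 0 := by positivity
  rw [mul_pow]
  field_simp
  linear_combination s ^ k * h

/-- The coefficients of s ↦ P(a + b s) are controlled by its norm on [0, 1], and they in turn bound
its values on [-1, 0]. The constant involves neither a nor b, which makes the neighbour constant
independent of the mesh size. -/
theorem exists_integral_reflect_le (p : ℕ) : ∃ K : ℝ, ∀ P : ℝ[X], P.natDegree ≤ p → ∀ a b : ℝ,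
    ∫ s in (0 : ℝ)..1, P.eval (a - b * s) ^ 2 ≤ K * ∫ s in (0 : ℝ)..1, P.eval (a + b * s) ^ 2 := by
  refine ⟨(p + 1) * ∑ k ∈ Finset.range (p + 1),
    ∑ n ∈ Finset.range (p + 1), (2 * n + 1) * (legendre n).coeff k ^ 2, fun P hP a b => ?_⟩
  set R := affineComp P a b with hR
  have hRd : R.natDegree ≤ p := (natDegree_affineComp_le P a b).trans hP
  have hc : ∀ k, R.coeff k ^ 2 ≤ (∑ n ∈ Finset.range (p + 1), (2 * n + 1) *
      (legendre n).coeff k ^ 2) * ∫ s in (0 : ℝ)..1, P.eval (a + b * s) ^ 2 := fun k => by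
    simpa [hR, eval_affineComp] using coeff_sq_le_integral (p + 1) k R
      (lt_of_le_of_lt (degree_le_of_natDegree_le hRd) (by exact_mod_cast Nat.lt_succ_self p))
  have hpt : ∀ s ∈ Set.Icc (0 : ℝ) 1, P.eval (a - b * s) ^ 2 ≤
      (p + 1) * ∑ k ∈ Finset.range (p + 1), R.coeff k ^ 2 := by
    intro s hs
    have e : P.eval (a - b * s) = R.eval (-s) := by rw [hR, eval_affineComp]; congr 1; ring
    rw [e, eval_eq_sum_range' (n := p + 1) (Nat.lt_succ_of_le hRd)]
    refine (sq_sum_le_card_mul_sum_sq).trans ?_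
    rw [Finset.card_range]
    push_cast
    refine mul_le_mul_of_nonneg_left (Finset.sum_le_sum fun k _ => ?_) (by positivity)
    rw [mul_pow, ← pow_mul, mul_comm k 2, pow_mul, neg_sq, ← pow_mul]
    exact mul_le_of_le_one_right (sq_nonneg _) (pow_le_one₀ hs.1 hs.2)
  have hint : ∫ s in (0 : ℝ)..1, P.eval (a - b * s) ^ 2 ≤
      ∫ _ in (0 : ℝ)..1, (p + 1) * ∑ k ∈ Finset.range (p + 1), R.coeff k ^ 2 :=
    intervalIntegral.integral_mono_on zero_le_one
      (Continuous.intervalIntegrable (by have := P.continuous; fun_prop) _ _) (by simp) hpt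
  refine hint.trans ?_
  rw [intervalIntegral.integral_const, sub_zero, one_smul, mul_assoc, Finset.sum_mul]
  exact mul_le_mul_of_nonneg_left (Finset.sum_le_sum fun k _ => hc k) (by positivity)

end Univariate

/-! ### Comparing two polynomials through the jumps of their derivatives -/

section WeightedTaylor

open Polynomial

/-- Cauchy–Schwarz for the vectors (√C, 1/√w_k) and (x/√C, √w_k y_k); the squared length of the
first is `weightL`. -/
theorem add_sum_sq_le {p : ℕ} {C x : ℝ} (hC : 0 < C) {w y : ℕ → ℝ}
    (hw : ∀ k ∈ Finset.Icc 1 p, 0 < w k) :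
    (x + ∑ k ∈ Finset.Icc 1 p, y k) ^ 2 ≤
      weightL C p w * (C⁻¹ * x ^ 2 + ∑ k ∈ Finset.Icc 1 p, w k * y k ^ 2) := by
  have h := Finset.sum_sq_le_sum_mul_sum_of_sq_le_mul (Finset.Icc 1 p) (r := y)
    (f := fun k => 1 / w k) (g := fun k => w k * y k ^ 2)
    (fun k hk => (one_div_pos.2 (hw k hk)).le)
    (fun k hk => mul_nonneg (hw k hk).le (sq_nonneg _))
    (fun k hk => le_of_eq (by have := (hw k hk).ne'; field_simp))
  have key := add_mul_sq_le (u := Real.sqrt C) (v := x / Real.sqrt C)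
    (Finset.sum_nonneg fun k hk => (one_div_pos.2 (hw k hk)).le)
    (Finset.sum_nonneg fun k hk => mul_nonneg (hw k hk).le (sq_nonneg _)) h
  have hs : Real.sqrt C ≠ 0 := (Real.sqrt_pos.2 hC).ne'
  rw [mul_div_cancel₀ _ hs, div_pow, Real.sq_sqrt hC.le] at key
  rw [weightL, inv_mul_eq_div]
  exact key

/-- Two polynomials agreeing at `a` are compared next to `a` by means of the jumps of their
derivatives at `a`. -/
theorem integral_sq_le_weightL_mul {p : ℕ} {C : ℝ} (hC : 0 < C) {w : ℕ → ℝ}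
    (hw : ∀ k ∈ Finset.Icc 1 p, 0 < w k) {P Q : ℝ[X]} (hP : P.natDegree ≤ p)
    (hQ : Q.natDegree ≤ p) {a : ℝ} (h0 : P.eval a = Q.eval a) (b : ℝ) :
    ∫ s in (0 : ℝ)..1, P.eval (a + b * s) ^ 2 ≤
      weightL C p w * (C⁻¹ * (∫ s in (0 : ℝ)..1, Q.eval (a + b * s) ^ 2) +
        ∑ k ∈ Finset.Icc 1 p, w k * (b ^ (2 * k) / ((2 * k + 1) * (k.factorial : ℝ) ^ 2)) *
          ((derivative^[k] P).eval a - (derivative^[k] Q).eval a) ^ 2) := by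
  set δ : ℕ → ℝ := fun k => (derivative^[k] P).eval a - (derivative^[k] Q).eval a with hδ
  have hpt : ∀ s : ℝ, P.eval (a + b * s) ^ 2 ≤ weightL C p w * (C⁻¹ * Q.eval (a + b * s) ^ 2 +
      ∑ k ∈ Finset.Icc 1 p, w k * (δ k * ((b * s) ^ k / k.factorial)) ^ 2) := by
    intro s
    have e : P.eval (a + b * s) = Q.eval (a + b * s) +
        ∑ k ∈ Finset.Icc 1 p, δ k * ((b * s) ^ k / k.factorial) := by
      -- The Taylor expansions at `a` are subtracted; the term k = 0 drops out by `h0`, and the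
      -- index is shifted to start at 1.
      rw [eval_add_mul_eq_sum P hP, eval_add_mul_eq_sum Q hQ, ← sub_eq_iff_eq_add',
        ← Finset.sum_sub_distrib, Finset.sum_range_succ', Finset.range_eq_Ico,
        Finset.sum_Ico_add' (fun k => (derivative^[k] P).eval a * ((b * s) ^ k / k.factorial) -
          (derivative^[k] Q).eval a * ((b * s) ^ k / k.factorial)) 0 p 1]
      simp only [Function.iterate_zero, id, h0, sub_self, add_zero, zero_add]
      refine Finset.sum_congr (by ext; simp) fun k _ => ?_
      rw [hδ]; ring
    rw [e]
    exact add_sum_sq_le hC hw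
  have cP := P.continuous
  have cQ := Q.continuous
  have hsum : ∀ s : ℝ, ∑ k ∈ Finset.Icc 1 p, w k * (δ k * ((b * s) ^ k / k.factorial)) ^ 2 =
      ∑ k ∈ Finset.Icc 1 p, (w k * (b ^ (2 * k) / (k.factorial : ℝ) ^ 2) * δ k ^ 2) *
        s ^ (2 * k) := fun s =>
    Finset.sum_congr rfl fun k _ => by ring
  calc ∫ s in (0 : ℝ)..1, P.eval (a + b * s) ^ 2
      ≤ ∫ s in (0 : ℝ)..1, weightL C p w * (C⁻¹ * Q.eval (a + b * s) ^ 2 +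
        ∑ k ∈ Finset.Icc 1 p, (w k * (b ^ (2 * k) / (k.factorial : ℝ) ^ 2) * δ k ^ 2) *
          s ^ (2 * k)) := by
        refine intervalIntegral.integral_mono_on zero_le_one
          (Continuous.intervalIntegrable (by fun_prop) _ _)
          (Continuous.intervalIntegrable (by fun_prop) _ _) fun s _ => ?_
        rw [← hsum]; exact hpt s
    _ = _ := by
        rw [intervalIntegral.integral_const_mul, intervalIntegral.integral_add,
          intervalIntegral.integral_const_mul, intervalIntegral.integral_finsetSum]
        · congr 2
          refine Finset.sum_congr rfl fun k _ => ?_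
          -- The integral of s²ᵏ is the source of the factor 1 / (2k + 1) in the stabilization.
          rw [intervalIntegral.integral_const_mul, integral_pow]
          have : (k.factorial : ℝ) ≠ 0 := by positivity
          simp only [one_pow, Nat.cast_mul, Nat.cast_ofNat, ne_eq, Nat.add_eq_zero_iff,
            one_ne_zero, and_false, not_false_eq_true, zero_pow, sub_zero]
          simp only [hδ]
          field_simp
        all_goals intros; exact Continuous.intervalIntegrable (by fun_prop) _ _

theorem iteratedDerivWithin_eval {P : ℝ[X]} {s : Set ℝ} (hs : UniqueDiffOn ℝ s) (k : ℕ) :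
    Set.EqOn (iteratedDerivWithin k (fun t => P.eval t) s)
      (fun t => (derivative^[k] P).eval t) s := by
  induction k with
  | zero => intro x _; simp
  | succ k ih =>
    intro x hx
    rw [iteratedDerivWithin_succ, derivWithin_congr ih (ih hx), Function.iterate_succ_apply']
    exact ((derivative^[k] P).hasDerivAt x).hasDerivWithinAt.derivWithin (hs x hx)

end WeightedTaylor

/-! ### Splitting a cell into a face and its normal direction -/

section Faces

variable {d : ℕ}

/-- The common face of the cells `c` and `nextCell c j` in the coordinates `x_i`, `i ≠ j`. -/
def faceBox (o : Fin d → ℝ) (h : ℝ) (c : Fin d → ℤ) (j : Fin d) :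
    Set ({i : Fin d // i ≠ j} → ℝ) :=
  {y | ∀ i : {i : Fin d // i ≠ j}, o i.1 + h * (c i.1 : ℝ) ≤ y i ∧
    y i ≤ o i.1 + h * ((c i.1 : ℝ) + 1)}

/-- The point with `j`-th coordinate `t` and the other coordinates given by `y`. -/
def glue (j : Fin d) (t : ℝ) (y : {i : Fin d // i ≠ j} → ℝ) : Fin d → ℝ :=
  fun i => if hi : i = j then t else y ⟨i, hi⟩

/-- The interval of the values of the `j`-th coordinate on a cell. -/
def side (o : Fin d → ℝ) (h : ℝ) (c : Fin d → ℤ) (j : Fin d) : Set ℝ :=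
  Set.Icc (o j + h * (c j : ℝ)) (o j + h * ((c j : ℝ) + 1))

theorem gridCell_eq_Icc (o : Fin d → ℝ) (h : ℝ) (c : Fin d → ℤ) :
    gridCell o h c = Set.Icc (fun i => o i + h * (c i : ℝ)) (fun i => o i + h * ((c i : ℝ) + 1)) := by
  ext x; simp [gridCell, Set.mem_Icc, Pi.le_def, forall_and]

theorem faceBox_eq_Icc (o : Fin d → ℝ) (h : ℝ) (c : Fin d → ℤ) (j : Fin d) :
    faceBox o h c j = Set.Icc (fun i => o i.1 + h * (c i.1 : ℝ))
      (fun i => o i.1 + h * ((c i.1 : ℝ) + 1)) := by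
  ext x; simp only [faceBox, Set.mem_Icc, Pi.le_def, ← forall_and]; rfl

theorem isCompact_gridCell (o : Fin d → ℝ) (h : ℝ) (c : Fin d → ℤ) :
    IsCompact (gridCell o h c) := by
  rw [gridCell_eq_Icc]; exact isCompact_Icc

theorem isCompact_faceBox (o : Fin d → ℝ) (h : ℝ) (c : Fin d → ℤ) (j : Fin d) :
    IsCompact (faceBox o h c j) := by
  rw [faceBox_eq_Icc]; exact isCompact_Icc

theorem glue_mem_gridCell {o : Fin d → ℝ} {h : ℝ} {c : Fin d → ℤ} {j : Fin d} {t : ℝ}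
    {y : {i : Fin d // i ≠ j} → ℝ} :
    glue j t y ∈ gridCell o h c ↔ y ∈ faceBox o h c j ∧ t ∈ side o h c j := by
  constructor
  · intro H
    refine ⟨fun i => ?_, ?_⟩
    · simpa [glue, i.2] using H i.1
    · simpa [glue, side] using H j
  · rintro ⟨hy, ht⟩ i
    by_cases hi : i = j
    · subst hi; simpa [glue, side] using ht
    · simpa [glue, hi] using hy ⟨i, hi⟩

theorem faceBox_nextCell (o : Fin d → ℝ) (h : ℝ) (c : Fin d → ℤ) (j : Fin d) :
    faceBox o h (nextCell c j) j = faceBox o h c j := by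
  ext y
  simp only [faceBox, Set.mem_ofPred_eq]
  refine forall_congr' fun i => ?_
  rw [nextCell, Function.update_of_ne i.2]

theorem update_glue (j : Fin d) (s t : ℝ) (y : {i : Fin d // i ≠ j} → ℝ) :
    Function.update (glue j t y) j s = glue j s y := by
  ext i
  by_cases hi : i = j
  · subst hi; simp [glue]
  · simp [glue, hi]

theorem continuous_glue (j : Fin d) :
    Continuous fun z : ({i : Fin d // i ≠ j} → ℝ) × ℝ => glue j z.2 z.1 := by
  refine continuous_pi fun i => ?_
  by_cases hi : i = j
  · simpa [glue, hi] using continuous_snd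
  · simp only [glue, hi, dite_false]; fun_prop

/-- Splitting off the `j`-th coordinate. -/
def glueEquiv (j : Fin d) : (({i : Fin d // i ≠ j} → ℝ) × ℝ) ≃ᵐ (Fin d → ℝ) :=
  MeasurableEquiv.prodComm.trans
    (((MeasurableEquiv.funUnique {i : Fin d // i = j} ℝ).symm.prodCongr
      (MeasurableEquiv.refl _)).trans
        (MeasurableEquiv.piEquivPiSubtypeProd (fun _ => ℝ) (fun i => i = j)).symm)

theorem glueEquiv_apply (j : Fin d) (z : ({i : Fin d // i ≠ j} → ℝ) × ℝ) :
    glueEquiv j z = glue j z.2 z.1 := by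
  ext i
  by_cases hi : i = j
  · simp [glueEquiv, glue, hi, MeasurableEquiv.piEquivPiSubtypeProd,
      Equiv.piEquivPiSubtypeProd, MeasurableEquiv.funUnique, MeasurableEquiv.prodCongr,
      MeasurableEquiv.prodComm]
  · simp [glueEquiv, glue, hi, MeasurableEquiv.piEquivPiSubtypeProd,
      Equiv.piEquivPiSubtypeProd, MeasurableEquiv.funUnique, MeasurableEquiv.prodCongr,
      MeasurableEquiv.prodComm]

theorem measurePreserving_glueEquiv (j : Fin d) :
    MeasurePreserving (glueEquiv j) (volume.prod volume) volume := by
  have h1 : MeasurePreserving (Prod.swap : ({i : Fin d // i ≠ j} → ℝ) × ℝ → _)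
      (volume.prod volume) (volume.prod volume) := Measure.measurePreserving_swap
  have h2 := (volume_preserving_funUnique {i : Fin d // i = j} ℝ).symm
  have h3 : MeasurePreserving (id : ({i : Fin d // i ≠ j} → ℝ) → _) volume volume :=
    MeasurePreserving.id _
  have h4 := (volume_preserving_piEquivPiSubtypeProd (fun _ : Fin d => ℝ) (fun i => i = j)).symm
  have h5 : MeasurePreserving (Prod.map (MeasurableEquiv.funUnique {i : Fin d // i = j} ℝ).symm
      (id : ({i : Fin d // i ≠ j} → ℝ) → _) ∘ Prod.swap) (volume.prod volume) volume :=
    (h2.prod h3).comp h1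
  exact h4.comp (by convert h5 <;> rfl)

theorem integral_gridCell (o : Fin d → ℝ) (h : ℝ) (c : Fin d → ℤ) (j : Fin d)
    {f : (Fin d → ℝ) → ℝ} (hf : Continuous f) :
    ∫ x in gridCell o h c, f x =
      ∫ y in faceBox o h c j, ∫ t in side o h c j, f (glue j t y) := by
  have hpre : glueEquiv j ⁻¹' gridCell o h c = faceBox o h c j ×ˢ side o h c j := by
    ext z; simp [glueEquiv_apply, glue_mem_gridCell]
  rw [← (measurePreserving_glueEquiv j).setIntegral_preimage_emb
    (glueEquiv j).measurableEmbedding, hpre]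
  simp only [glueEquiv_apply]
  refine setIntegral_prod (fun z => f (glue j z.2 z.1)) ?_
  exact (hf.comp (continuous_glue j)).continuousOn.integrableOn_compact
    ((isCompact_faceBox o h c j).prod isCompact_Icc)

/-- The coordinate `x_j` on the face between `c` and `nextCell c j`. -/
def faceCoord (o : Fin d → ℝ) (h : ℝ) (c : Fin d → ℤ) (j : Fin d) : ℝ :=
  o j + h * ((c j : ℝ) + 1)

/-- The integral over the cell on the side `b = ± h` of the face between `c` and `nextCell c j`. -/
def sideIntegral (o : Fin d → ℝ) (h : ℝ) (c : Fin d → ℤ) (j : Fin d) (b : ℝ)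
    (f : (Fin d → ℝ) → ℝ) : ℝ :=
  h * ∫ y in faceBox o h c j, ∫ s in (0 : ℝ)..1, f (glue j (faceCoord o h c j + b * s) y)

theorem sideIntegral_pos_eq {h : ℝ} (hh : 0 < h) (o : Fin d → ℝ) (c : Fin d → ℤ) (j : Fin d)
    {f : (Fin d → ℝ) → ℝ} (hf : Continuous f) :
    sideIntegral o h c j h f = ∫ x in gridCell o h (nextCell c j), f x := by
  rw [integral_gridCell o h _ j hf, faceBox_nextCell, sideIntegral, ← integral_const_mul]
  congr 1; ext y
  have hs : side o h (nextCell c j) j =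
      Set.Icc (faceCoord o h c j + h * 0) (faceCoord o h c j + h * 1) := by
    simp only [side, nextCell, faceCoord, Function.update_self]; push_cast; congr 1 <;> ring
  rw [hs, integral_Icc_eq_integral_Ioc, ← intervalIntegral.integral_of_le (by nlinarith),
    ← intervalIntegral.mul_integral_comp_add_mul (f := fun t => f (glue j t y))]

theorem sideIntegral_neg_eq {h : ℝ} (hh : 0 < h) (o : Fin d → ℝ) (c : Fin d → ℤ) (j : Fin d)
    {f : (Fin d → ℝ) → ℝ} (hf : Continuous f) :
    sideIntegral o h c j (-h) f = ∫ x in gridCell o h c, f x := by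
  rw [integral_gridCell o h _ j hf, sideIntegral, ← integral_const_mul]
  congr 1; ext y
  -- The substitution t = a - h s reverses orientation, so the lower end of the side corresponds to
  -- s = 1.
  have hs : side o h c j =
      Set.Icc (faceCoord o h c j + -h * 1) (faceCoord o h c j + -h * 0) := by
    simp only [side, faceCoord]; congr 1 <;> ring
  rw [hs, integral_Icc_eq_integral_Ioc, ← intervalIntegral.integral_of_le (by nlinarith),
    intervalIntegral.integral_symm,
    ← intervalIntegral.mul_integral_comp_add_mul (f := fun t => f (glue j t y))]
  ring

theorem continuous_intervalIntegral_glue (j : Fin d) (a b : ℝ) {f : (Fin d → ℝ) → ℝ}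
    (hf : Continuous f) :
    Continuous fun y : {i : Fin d // i ≠ j} → ℝ =>
      ∫ s in (0 : ℝ)..1, f (glue j (a + b * s) y) := by
  refine intervalIntegral.continuous_parametric_intervalIntegral_of_continuous' ?_ 0 1
  have h := hf.comp ((continuous_glue j).comp
    (f := fun z : ({i : Fin d // i ≠ j} → ℝ) × ℝ => (z.1, a + b * z.2)) (by fun_prop))
  exact h

theorem continuous_glue_left (j : Fin d) (a : ℝ) :
    Continuous fun y : {i : Fin d // i ≠ j} → ℝ => glue j a y :=
  (continuous_glue j).comp (f := fun y : {i : Fin d // i ≠ j} → ℝ => (y, a)) (by fun_prop)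

/-- The restriction of a polynomial to a line parallel to the `j`-th axis. -/
def slice (q : MvPolynomial (Fin d) ℝ) (j : Fin d) (y : {i : Fin d // i ≠ j} → ℝ) :
    Polynomial ℝ :=
  MvPolynomial.aeval (fun i => if hi : i = j then Polynomial.X else Polynomial.C (y ⟨i, hi⟩)) q

theorem eval_slice (q : MvPolynomial (Fin d) ℝ) (j : Fin d) (y : {i : Fin d // i ≠ j} → ℝ)
    (t : ℝ) : (slice q j y).eval t = MvPolynomial.eval (glue j t y) q := by
  induction q using MvPolynomial.induction_on with
  | C a => simp [slice]
  | add p q hp hq => simpa [slice] using congrArg₂ (· + ·) hp hq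
  | mul_X p i hp =>
    have hp' : (slice (p * MvPolynomial.X i) j y) = slice p j y *
        (if hi : i = j then Polynomial.X else Polynomial.C (y ⟨i, hi⟩)) := by simp [slice]
    rw [hp', Polynomial.eval_mul, hp, map_mul, MvPolynomial.eval_X, glue]
    split_ifs <;> simp

theorem derivative_slice (q : MvPolynomial (Fin d) ℝ) (j : Fin d)
    (y : {i : Fin d // i ≠ j} → ℝ) :
    Polynomial.derivative (slice q j y) = slice (MvPolynomial.pderiv j q) j y := by
  induction q using MvPolynomial.induction_on with
  | C a => simp [slice]
  | add p q hp hq => simpa [slice] using congrArg₂ (· + ·) hp hq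
  | mul_X p i hp =>
    have hp' : ∀ p, (slice (p * MvPolynomial.X i) j y) = slice p j y *
        (if hi : i = j then Polynomial.X else Polynomial.C (y ⟨i, hi⟩)) := fun p => by simp [slice]
    have ha : ∀ p q, slice (p + q) j y = slice p j y + slice q j y := fun p q => by simp [slice]
    rw [hp', Polynomial.derivative_mul, hp, MvPolynomial.pderiv_mul, ha, hp']
    by_cases hi : i = j
    · subst hi; simp
    · simp [hi, slice]

/-- Exhibits the normal derivatives as slices of a fixed multivariate polynomial, hence as
continuous functions of the face variable. -/
theorem iterate_derivative_slice (q : MvPolynomial (Fin d) ℝ) (j : Fin d)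
    (y : {i : Fin d // i ≠ j} → ℝ) (k : ℕ) :
    Polynomial.derivative^[k] (slice q j y) = slice ((MvPolynomial.pderiv j)^[k] q) j y := by
  induction k with
  | zero => rfl
  | succ k ih => rw [Function.iterate_succ_apply', ih, derivative_slice,
      Function.iterate_succ_apply']

theorem continuous_eval_iterate_derivative_slice (q : MvPolynomial (Fin d) ℝ) (j : Fin d)
    (k : ℕ) (a : ℝ) :
    Continuous fun y => (Polynomial.derivative^[k] (slice q j y)).eval a := by
  simp only [iterate_derivative_slice, eval_slice]
  exact (MvPolynomial.continuous_eval _).comp (continuous_glue_left j a)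

theorem natDegree_slice_le (q : MvPolynomial (Fin d) ℝ) (j : Fin d)
    (y : {i : Fin d // i ≠ j} → ℝ) : (slice q j y).natDegree ≤ q.degreeOf j := by
  rw [slice, MvPolynomial.aeval_def, MvPolynomial.eval₂_eq]
  refine Polynomial.natDegree_sum_le_of_forall_le _ _ fun m hm => ?_
  rw [Polynomial.algebraMap_eq]
  refine (Polynomial.natDegree_C_mul_le _ _).trans ?_
  refine (Polynomial.natDegree_prod_le _ _).trans ?_
  refine le_trans (Finset.sum_le_sum (g := fun i => if i = j then m j else 0) fun i _ => ?_) ?_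
  · split_ifs with hi
    · subst hi; simp
    · refine Polynomial.natDegree_pow_le.trans ?_
      simp
  · rw [Finset.sum_ite_eq' m.support j]
    split_ifs
    · exact MvPolynomial.monomial_le_degreeOf j hm
    · exact Nat.zero_le _

end Faces

/-! ### The univariate inequalities integrated over a face -/

section FaceInequalities

variable {d : ℕ} {o : Fin d → ℝ} {h : ℝ} {c : Fin d → ℤ} {j : Fin d}

/-- The `k`-th derivative of the polynomial `q` in direction `x_j` on the face between `c` and
`nextCell c j`. -/
def faceDeriv (o : Fin d → ℝ) (h : ℝ) (c : Fin d → ℤ) (j : Fin d) (k : ℕ)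
    (q : MvPolynomial (Fin d) ℝ) (y : {i : Fin d // i ≠ j} → ℝ) : ℝ :=
  (Polynomial.derivative^[k] (slice q j y)).eval (faceCoord o h c j)

theorem continuous_faceDeriv (k : ℕ) (q : MvPolynomial (Fin d) ℝ) :
    Continuous (faceDeriv o h c j k q) :=
  continuous_eval_iterate_derivative_slice q j k _

theorem continuous_integral_sq_slice (q : MvPolynomial (Fin d) ℝ) (a b : ℝ) :
    Continuous fun y : {i : Fin d // i ≠ j} → ℝ =>
      ∫ s in (0 : ℝ)..1, (slice q j y).eval (a + b * s) ^ 2 := by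
  simp only [eval_slice]
  exact continuous_intervalIntegral_glue j a b (f := fun x => MvPolynomial.eval x q ^ 2)
    ((MvPolynomial.continuous_eval q).pow 2)

theorem sideIntegral_sq_eq (q : MvPolynomial (Fin d) ℝ) (b : ℝ) :
    sideIntegral o h c j b (fun x => MvPolynomial.eval x q ^ 2) =
      h * ∫ y in faceBox o h c j, ∫ s in (0 : ℝ)..1,
        (slice q j y).eval (faceCoord o h c j + b * s) ^ 2 := by
  simp only [sideIntegral, eval_slice]

theorem _root_.Continuous.integrableOn_faceBox {f : ({i : Fin d // i ≠ j} → ℝ) → ℝ}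
    (hf : Continuous f) : IntegrableOn f (faceBox o h c j) :=
  hf.continuousOn.integrableOn_compact (isCompact_faceBox o h c j)

theorem measurableSet_faceBox : MeasurableSet (faceBox o h c j) :=
  (isCompact_faceBox o h c j).isClosed.measurableSet

/-- In the application `r` is the neighbour's polynomial, continued across the face, so both side
integrals are over the same cell. Only even powers of `b` occur, so b = h and b = -h are treated at
once; the factor h in `sideIntegral` raises h²ᵏ to h²ᵏ⁺¹. -/
theorem sideIntegral_sq_le {p : ℕ} {C : ℝ} (hC : 0 < C) {w : ℕ → ℝ}
    (hw : ∀ k ∈ Finset.Icc 1 p, 0 < w k) (hh : 0 < h) {b : ℝ} (hb : b ^ 2 = h ^ 2)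
    {q r : MvPolynomial (Fin d) ℝ} (hq : ∀ i, q.degreeOf i ≤ p) (hr : ∀ i, r.degreeOf i ≤ p)
    (h0 : ∀ y ∈ faceBox o h c j, MvPolynomial.eval (glue j (faceCoord o h c j) y) q =
      MvPolynomial.eval (glue j (faceCoord o h c j) y) r) :
    sideIntegral o h c j b (fun x => MvPolynomial.eval x q ^ 2) ≤
      weightL C p w * (C⁻¹ * sideIntegral o h c j b (fun x => MvPolynomial.eval x r ^ 2) +
        ∑ k ∈ Finset.Icc 1 p, w k * (h ^ (2 * k + 1) / ((2 * k + 1) * (k.factorial : ℝ) ^ 2)) *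
          ∫ y in faceBox o h c j, (faceDeriv o h c j k q y - faceDeriv o h c j k r y) ^ 2) := by
  have hbk : ∀ k, b ^ (2 * k) = h ^ (2 * k) := fun k => by rw [pow_mul, hb, ← pow_mul]
  have c1 := continuous_integral_sq_slice (j := j) r (faceCoord o h c j) b
  have c2 : ∀ k, Continuous fun y => (faceDeriv o h c j k q y - faceDeriv o h c j k r y) ^ 2 :=
    fun k => ((continuous_faceDeriv k q).sub (continuous_faceDeriv k r)).pow 2
  rw [sideIntegral_sq_eq, sideIntegral_sq_eq]
  have key := setIntegral_mono_on
    (f := fun y => ∫ s in (0 : ℝ)..1, (slice q j y).eval (faceCoord o h c j + b * s) ^ 2)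
    (g := fun y => weightL C p w *
      (C⁻¹ * (∫ s in (0 : ℝ)..1, (slice r j y).eval (faceCoord o h c j + b * s) ^ 2) +
        ∑ k ∈ Finset.Icc 1 p, w k * (h ^ (2 * k) / ((2 * k + 1) * (k.factorial : ℝ) ^ 2)) *
          (faceDeriv o h c j k q y - faceDeriv o h c j k r y) ^ 2))
    (s := faceBox o h c j) (μ := volume)
    (continuous_integral_sq_slice q _ _).integrableOn_faceBox
    (Continuous.integrableOn_faceBox (by fun_prop)) measurableSet_faceBox
    (fun y hy => by
      have := integral_sq_le_weightL_mul hC hw ((natDegree_slice_le q j y).trans (hq j))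
        ((natDegree_slice_le r j y).trans (hr j)) (a := faceCoord o h c j)
        (by rw [eval_slice, eval_slice]; exact h0 y hy) b
      simp only [hbk] at this
      exact this)
  rw [integral_const_mul, integral_add (Continuous.integrableOn_faceBox (by fun_prop))
    (Continuous.integrableOn_faceBox (by fun_prop)), integral_const_mul,
    integral_finsetSum _ (fun k _ => Continuous.integrableOn_faceBox (by fun_prop))] at key
  simp only [integral_const_mul] at key
  refine (mul_le_mul_of_nonneg_left key hh.le).trans (le_of_eq ?_)
  rw [mul_left_comm h, mul_add h, Finset.mul_sum]
  congr 2
  · ring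
  · refine Finset.sum_congr rfl fun k _ => ?_
    rw [pow_succ]; ring

theorem integral_sq_faceDeriv_le {p k : ℕ} (hp : 1 ≤ p) (hk : k ≤ p) (hh : 0 < h) {b : ℝ}
    (hb : b ^ 2 = h ^ 2) {q : MvPolynomial (Fin d) ℝ} (hq : ∀ i, q.degreeOf i ≤ p) :
    h ^ (2 * k + 1) * ∫ y in faceBox o h c j, faceDeriv o h c j k q y ^ 2 ≤
      36 * (p : ℝ) ^ (4 * k + 2) *
        sideIntegral o h c j b (fun x => MvPolynomial.eval x q ^ 2) := by
  have hbk : b ^ (2 * k) = h ^ (2 * k) := by rw [pow_mul, hb, ← pow_mul]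
  rw [sideIntegral_sq_eq]
  have c1 := continuous_integral_sq_slice (j := j) q (faceCoord o h c j) b
  have c2 : Continuous fun y => faceDeriv o h c j k q y ^ 2 := (continuous_faceDeriv k q).pow 2
  have key := setIntegral_mono_on
    (f := fun y => h ^ (2 * k) * faceDeriv o h c j k q y ^ 2)
    (g := fun y => 36 * (p : ℝ) ^ (4 * k + 2) *
      ∫ s in (0 : ℝ)..1, (slice q j y).eval (faceCoord o h c j + b * s) ^ 2)
    (s := faceBox o h c j) (μ := volume)
    (Continuous.integrableOn_faceBox (by fun_prop))
    (Continuous.integrableOn_faceBox (by fun_prop)) measurableSet_faceBox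
    (fun y _ => by
      have := sq_iterate_derivative_le_integral hp hk (slice q j y)
        ((natDegree_slice_le q j y).trans (hq j)) (faceCoord o h c j) b
      rwa [hbk] at this)
  rw [integral_const_mul, integral_const_mul] at key
  calc _ = h * (h ^ (2 * k) * ∫ y in faceBox o h c j, faceDeriv o h c j k q y ^ 2) := by
        rw [pow_succ]; ring
    _ ≤ _ := mul_le_mul_of_nonneg_left key hh.le
    _ = _ := by ring

theorem exists_isNeighbourConst (d p : ℕ) : ∃ C, IsNeighbourConst d p C := by
  obtain ⟨K, hK⟩ := exists_integral_reflect_le p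
  have main : ∀ (o : Fin d → ℝ) (h : ℝ), 0 < h → ∀ (c : Fin d → ℤ) (j : Fin d)
      (q : MvPolynomial (Fin d) ℝ), (∀ i, q.degreeOf i ≤ p) → ∀ b : ℝ,
      sideIntegral o h c j (-b) (fun x => MvPolynomial.eval x q ^ 2) ≤
        K * sideIntegral o h c j b (fun x => MvPolynomial.eval x q ^ 2) := by
    intro o h hh c j q hq b
    rw [sideIntegral_sq_eq, sideIntegral_sq_eq, mul_left_comm, ← integral_const_mul K]
    have c1 := continuous_integral_sq_slice (j := j) q (faceCoord o h c j) b
    refine mul_le_mul_of_nonneg_left (setIntegral_mono_on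
      (continuous_integral_sq_slice q _ _).integrableOn_faceBox
      (c1.const_mul K).integrableOn_faceBox measurableSet_faceBox fun y _ => ?_) hh.le
    have := hK (slice q j y) ((natDegree_slice_le q j y).trans (hq j)) (faceCoord o h c j) b
    simpa only [neg_mul, ← sub_eq_add_neg] using this
  refine ⟨K, fun o h hh c c' hcc q hq => ?_⟩
  have hcont : Continuous fun x => MvPolynomial.eval x q ^ 2 :=
    (MvPolynomial.continuous_eval q).pow 2
  obtain ⟨j, rfl | rfl⟩ := hcc
  · have := main o h hh c j q hq h
    rwa [sideIntegral_pos_eq hh o c j hcont, sideIntegral_neg_eq hh o c j hcont] at this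
  · have := main o h hh c' j q hq (-h)
    rwa [neg_neg, sideIntegral_pos_eq hh o c' j hcont, sideIntegral_neg_eq hh o c' j hcont] at this

/-- Tested with the constant 1 on two unit cells; in dimension 0 there would be no neighbours and
hence no constraint on `C`. -/
theorem IsNeighbourConst.one_le {d p : ℕ} (hd : 1 ≤ d) {C : ℝ} (hC : IsNeighbourConst d p C) :
    1 ≤ C := by
  have hvol : ∀ c : Fin d → ℤ, volume.real (gridCell (0 : Fin d → ℝ) 1 c) = 1 := fun c => by
    rw [gridCell_eq_Icc, Measure.real, Real.volume_Icc_pi_toReal (fun i => by simp)]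
    simp
  have := hC 0 1 one_pos 0 (nextCell 0 ⟨0, hd⟩) ⟨⟨0, hd⟩, Or.inl rfl⟩ 1 (by simp)
  simpa [hvol] using this

end FaceInequalities

/-! ### Energies of cells and faces, and their comparison across one face -/

namespace ImmersedDomain

variable {d : ℕ} (D : ImmersedDomain d) {p : ℕ}

/-- On the cell `c` the function `v` is the polynomial `q`, of degree at most `p` in each
variable. -/
structure IsLocalPoly (p : ℕ) (v : (Fin d → ℝ) → ℝ) (c : Fin d → ℤ)
    (q : MvPolynomial (Fin d) ℝ) : Prop where
  degreeOf_le : ∀ i, q.degreeOf i ≤ p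
  eq_eval : ∀ x ∈ D.cell c, v x = MvPolynomial.eval x q

variable {D}

theorem exists_isLocalPoly {v : (Fin d → ℝ) → ℝ} (hv : v ∈ D.feSpace p) {c : Fin d → ℤ}
    (hc : c ∈ D.cells) : ∃ q, D.IsLocalPoly p v c q := by
  obtain ⟨q, hq, hqv⟩ := hv.2.2 c hc
  exact ⟨q, hq, hqv⟩

theorem cellDeriv_glue {v : (Fin d → ℝ) → ℝ} {c : Fin d → ℤ} {q : MvPolynomial (Fin d) ℝ}
    (hq : D.IsLocalPoly p v c q) (j : Fin d) (k : ℕ) {y : {i : Fin d // i ≠ j} → ℝ}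
    (hy : y ∈ faceBox D.o D.h c j) {t : ℝ} (ht : t ∈ side D.o D.h c j) :
    D.cellDeriv c j k v (glue j t y) = (Polynomial.derivative^[k] (slice q j y)).eval t := by
  have e : Set.EqOn (fun s => v (Function.update (glue j t y) j s))
      (fun s => (slice q j y).eval s) (side D.o D.h c j) := fun s hs => by
    simp only [update_glue, eval_slice]
    exact hq.eq_eval _ (glue_mem_gridCell.2 ⟨hy, hs⟩)
  have hg : glue j t y j = t := by simp [glue]
  rw [cellDeriv, hg]
  refine (iteratedDerivWithin_congr e ht).trans (iteratedDerivWithin_eval ?_ k ht)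
  exact uniqueDiffOn_Icc (by nlinarith [D.h_pos])

theorem faceCoord_mem_side (c : Fin d → ℤ) (j : Fin d) :
    faceCoord D.o D.h c j ∈ side D.o D.h c j ∧
      faceCoord D.o D.h c j ∈ side D.o D.h (nextCell c j) j := by
  have := D.h_pos
  simp only [faceCoord, side, nextCell, Function.update_self, Set.mem_Icc, Int.cast_add,
    Int.cast_one]
  refine ⟨⟨?_, le_rfl⟩, le_rfl, ?_⟩ <;> nlinarith

theorem jump_glue {v : (Fin d → ℝ) → ℝ} {c : Fin d → ℤ} {j : Fin d}
    {q r : MvPolynomial (Fin d) ℝ} (hq : D.IsLocalPoly p v c q)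
    (hr : D.IsLocalPoly p v (nextCell c j) r) (k : ℕ) {y : {i : Fin d // i ≠ j} → ℝ}
    (hy : y ∈ faceBox D.o D.h c j) :
    D.jump c j k v (glue j (faceCoord D.o D.h c j) y) =
      faceDeriv D.o D.h c j k r y - faceDeriv D.o D.h c j k q y := by
  have hs := faceCoord_mem_side (D := D) c j
  rw [jump, cellDeriv_glue hq j k hy hs.1,
    cellDeriv_glue hr j k (by rwa [faceBox_nextCell]) hs.2]
  rfl

theorem faceIntegral_eq (c : Fin d → ℤ) (j : Fin d) (f : (Fin d → ℝ) → ℝ) :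
    D.faceIntegral c j f =
      ∫ y in faceBox D.o D.h c j, f (glue j (faceCoord D.o D.h c j) y) := rfl

theorem faceIntegral_jump_mul_jump {u v : (Fin d → ℝ) → ℝ} {c : Fin d → ℤ} {j : Fin d}
    {q r q' r' : MvPolynomial (Fin d) ℝ} (hq : D.IsLocalPoly p u c q)
    (hr : D.IsLocalPoly p u (nextCell c j) r) (hq' : D.IsLocalPoly p v c q')
    (hr' : D.IsLocalPoly p v (nextCell c j) r') (k : ℕ) :
    D.faceIntegral c j (fun x => D.jump c j k u x * D.jump c j k v x) =
      ∫ y in faceBox D.o D.h c j, (faceDeriv D.o D.h c j k r y - faceDeriv D.o D.h c j k q y) *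
        (faceDeriv D.o D.h c j k r' y - faceDeriv D.o D.h c j k q' y) := by
  rw [faceIntegral_eq]
  refine setIntegral_congr_fun measurableSet_faceBox fun y hy => ?_
  simp only [jump_glue hq hr k hy, jump_glue hq' hr' k hy]

variable (D) in
/-- The contribution of one face to the stabilization. -/
def faceEnergy (p : ℕ) (w : ℕ → ℝ) (v : (Fin d → ℝ) → ℝ) (F : (Fin d → ℤ) × Fin d) : ℝ :=
  ∑ k ∈ Finset.Icc 1 p, w k * (D.h ^ (2 * k + 1) / ((2 * k + 1) * (k.factorial : ℝ) ^ 2)) *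
    D.faceIntegral F.1 F.2 (fun x => D.jump F.1 F.2 k v x * D.jump F.1 F.2 k v x)

variable (D) in
/-- The squared `L²` norm on one cell. -/
def cellEnergy (v : (Fin d → ℝ) → ℝ) (c : Fin d → ℤ) : ℝ := ∫ x in D.cell c, v x ^ 2

theorem cellEnergy_nonneg (v : (Fin d → ℝ) → ℝ) (c : Fin d → ℤ) : 0 ≤ D.cellEnergy v c :=
  integral_nonneg fun _ => sq_nonneg _

theorem faceEnergy_nonneg {w : ℕ → ℝ} (hw : ∀ k ∈ Finset.Icc 1 p, 0 < w k)
    (v : (Fin d → ℝ) → ℝ) (F : (Fin d → ℤ) × Fin d) : 0 ≤ D.faceEnergy p w v F := by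
  refine Finset.sum_nonneg fun k hk => mul_nonneg (mul_nonneg (hw k hk).le ?_) ?_
  · have := D.h_pos; positivity
  · exact integral_nonneg fun _ => mul_self_nonneg _

theorem stab_self (w : ℕ → ℝ) (v : (Fin d → ℝ) → ℝ) :
    D.stab p w v v = ∑ F ∈ D.cutFaces, D.faceEnergy p w v F := rfl

theorem measurableSet_cell (c : Fin d → ℤ) : MeasurableSet (D.cell c) :=
  (isCompact_gridCell D.o D.h c).isClosed.measurableSet

theorem cellEnergy_eq {v : (Fin d → ℝ) → ℝ} {c : Fin d → ℤ} {q : MvPolynomial (Fin d) ℝ}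
    (hq : D.IsLocalPoly p v c q) :
    D.cellEnergy v c = ∫ x in gridCell D.o D.h c, MvPolynomial.eval x q ^ 2 :=
  setIntegral_congr_fun (measurableSet_cell c) fun x hx => by
    simp only [hq.eq_eval x hx]

/-- `sideIntegral_sq_le` leaves C⁻¹ times the norm of the neighbour's polynomial on the wrong cell.
By `IsNeighbourConst` this is at most the neighbour's own energy, so no separate factor `C` remains.
-/
theorem cellEnergy_le_of_face {C : ℝ} (hC : 0 < C) (hN : IsNeighbourConst d p C) {w : ℕ → ℝ}
    (hw : ∀ k ∈ Finset.Icc 1 p, 0 < w k) {v : (Fin d → ℝ) → ℝ} (hv : v ∈ D.feSpace p)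
    {c : Fin d → ℤ} {j : Fin d} (hc : c ∈ D.cells) (hc' : nextCell c j ∈ D.cells) :
    D.cellEnergy v (nextCell c j) ≤
        weightL C p w * (D.cellEnergy v c + D.faceEnergy p w v (c, j)) ∧
      D.cellEnergy v c ≤
        weightL C p w * (D.cellEnergy v (nextCell c j) + D.faceEnergy p w v (c, j)) := by
  obtain ⟨q, hq⟩ := exists_isLocalPoly hv hc
  obtain ⟨r, hr⟩ := exists_isLocalPoly hv hc'
  have hh := D.h_pos
  have hL : 0 ≤ weightL C p w :=
    add_nonneg hC.le (Finset.sum_nonneg fun k hk => (one_div_pos.2 (hw k hk)).le)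
  have hs := faceCoord_mem_side (D := D) c j
  have h0 : ∀ y ∈ faceBox D.o D.h c j,
      MvPolynomial.eval (glue j (faceCoord D.o D.h c j) y) r =
        MvPolynomial.eval (glue j (faceCoord D.o D.h c j) y) q := fun y hy => by
    rw [← hq.eq_eval _ (glue_mem_gridCell.2 ⟨hy, hs.1⟩),
      ← hr.eq_eval _ (glue_mem_gridCell.2 ⟨by rwa [faceBox_nextCell], hs.2⟩)]
  have hF : D.faceEnergy p w v (c, j) = ∑ k ∈ Finset.Icc 1 p,
      w k * (D.h ^ (2 * k + 1) / ((2 * k + 1) * (k.factorial : ℝ) ^ 2)) *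
        ∫ y in faceBox D.o D.h c j,
          (faceDeriv D.o D.h c j k r y - faceDeriv D.o D.h c j k q y) ^ 2 := by
    refine Finset.sum_congr rfl fun k _ => ?_
    rw [faceIntegral_jump_mul_jump hq hr hq hr]
    simp only [sq]
  have hF' : D.faceEnergy p w v (c, j) = ∑ k ∈ Finset.Icc 1 p,
      w k * (D.h ^ (2 * k + 1) / ((2 * k + 1) * (k.factorial : ℝ) ^ 2)) *
        ∫ y in faceBox D.o D.h c j,
          (faceDeriv D.o D.h c j k q y - faceDeriv D.o D.h c j k r y) ^ 2 := by
    rw [hF]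
    simp only [sub_sq_comm]
  have cq : Continuous fun x => MvPolynomial.eval x q ^ 2 :=
    (MvPolynomial.continuous_eval q).pow 2
  have cr : Continuous fun x => MvPolynomial.eval x r ^ 2 :=
    (MvPolynomial.continuous_eval r).pow 2
  have key1 := sideIntegral_sq_le (c := c) (j := j) hC hw hh (b := D.h) rfl hr.degreeOf_le
    hq.degreeOf_le h0
  have key2 := sideIntegral_sq_le (c := c) (j := j) hC hw hh (b := -D.h) (neg_sq _)
    hq.degreeOf_le hr.degreeOf_le (fun y hy => (h0 y hy).symm)
  rw [sideIntegral_pos_eq hh _ _ _ cr, sideIntegral_pos_eq hh _ _ _ cq, ← hF,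
    ← cellEnergy_eq hr] at key1
  rw [sideIntegral_neg_eq hh _ _ _ cr, sideIntegral_neg_eq hh _ _ _ cq, ← hF',
    ← cellEnergy_eq hq] at key2
  have n1 := hN D.o D.h hh (nextCell c j) c ⟨j, Or.inr rfl⟩ q hq.degreeOf_le
  have n2 := hN D.o D.h hh c (nextCell c j) ⟨j, Or.inl rfl⟩ r hr.degreeOf_le
  rw [← cellEnergy_eq hq, ← inv_mul_le_iff₀ hC] at n1
  rw [← cellEnergy_eq hr, ← inv_mul_le_iff₀ hC] at n2
  exact ⟨key1.trans (mul_le_mul_of_nonneg_left (by linarith) hL),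
    key2.trans (mul_le_mul_of_nonneg_left (by linarith) hL)⟩

/-- The jump is split by (a - b)² ≤ 2 (a² + b²) and each trace is bounded on its own cell by the
inverse inequality, whence 72 = 2 · 36. -/
theorem faceEnergy_le (hp : 1 ≤ p) {w : ℕ → ℝ}
    (hw : ∀ k ∈ Finset.Icc 1 p, 0 < w k) {v : (Fin d → ℝ) → ℝ} (hv : v ∈ D.feSpace p)
    {c : Fin d → ℤ} {j : Fin d} (hc : c ∈ D.cells) (hc' : nextCell c j ∈ D.cells) :
    D.faceEnergy p w v (c, j) ≤
      72 * weightG p w * (D.cellEnergy v c + D.cellEnergy v (nextCell c j)) := by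
  obtain ⟨q, hq⟩ := exists_isLocalPoly hv hc
  obtain ⟨r, hr⟩ := exists_isLocalPoly hv hc'
  have hh := D.h_pos
  have cq : Continuous fun x => MvPolynomial.eval x q ^ 2 :=
    (MvPolynomial.continuous_eval q).pow 2
  have cr : Continuous fun x => MvPolynomial.eval x r ^ 2 :=
    (MvPolynomial.continuous_eval r).pow 2
  rw [faceEnergy, weightG, Finset.mul_sum, Finset.sum_mul]
  refine Finset.sum_le_sum fun k hk => ?_
  have hkp := (Finset.mem_Icc.1 hk).2
  rw [faceIntegral_jump_mul_jump hq hr hq hr]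
  have iq := integral_sq_faceDeriv_le (o := D.o) (c := c) (j := j) hp hkp hh (b := -D.h) (neg_sq _)
    hq.degreeOf_le
  have ir := integral_sq_faceDeriv_le (o := D.o) (c := c) (j := j) hp hkp hh (b := D.h) rfl
    hr.degreeOf_le
  rw [sideIntegral_neg_eq hh _ _ _ cq, ← cellEnergy_eq hq] at iq
  rw [sideIntegral_pos_eq hh _ _ _ cr, ← cellEnergy_eq hr] at ir
  have c1 := continuous_faceDeriv (o := D.o) (h := D.h) (c := c) (j := j) k q
  have c2 := continuous_faceDeriv (o := D.o) (h := D.h) (c := c) (j := j) k r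
  have hj := setIntegral_mono_on
    (f := fun y => (faceDeriv D.o D.h c j k r y - faceDeriv D.o D.h c j k q y) *
        (faceDeriv D.o D.h c j k r y - faceDeriv D.o D.h c j k q y))
    (g := fun y => 2 * (faceDeriv D.o D.h c j k r y ^ 2 + faceDeriv D.o D.h c j k q y ^ 2))
    (s := faceBox D.o D.h c j) (μ := volume)
    (Continuous.integrableOn_faceBox (by fun_prop))
    (Continuous.integrableOn_faceBox (by fun_prop)) measurableSet_faceBox
    (fun y _ => by
      nlinarith [sq_nonneg (faceDeriv D.o D.h c j k r y + faceDeriv D.o D.h c j k q y)])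
  rw [integral_const_mul, integral_add (Continuous.integrableOn_faceBox (by fun_prop))
    (Continuous.integrableOn_faceBox (by fun_prop))] at hj
  have hpos : 0 ≤ w k / ((2 * k + 1) * (k.factorial : ℝ) ^ 2) :=
    div_nonneg (hw k hk).le (by positivity)
  have hhk : 0 ≤ D.h ^ (2 * k + 1) := by positivity
  calc _ = w k / ((2 * k + 1) * (k.factorial : ℝ) ^ 2) * (D.h ^ (2 * k + 1) *
        ∫ y in faceBox D.o D.h c j, (faceDeriv D.o D.h c j k r y - faceDeriv D.o D.h c j k q y) *
          (faceDeriv D.o D.h c j k r y - faceDeriv D.o D.h c j k q y)) := by ring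
    _ ≤ w k / ((2 * k + 1) * (k.factorial : ℝ) ^ 2) * (72 * (p : ℝ) ^ (4 * k + 2) *
        (D.cellEnergy v c + D.cellEnergy v (nextCell c j))) := by
        refine mul_le_mul_of_nonneg_left ?_ hpos
        have := mul_le_mul_of_nonneg_left hj hhk
        linarith
    _ = _ := by ring

end ImmersedDomain

/-! ### Counting and topology of grid cells -/

theorem sum_ite_comp_le {α β : Type*} [DecidableEq β] (S : Finset α) (T : Finset β) {g : α → β}
    (hg : Function.Injective g) {f : β → ℝ} (hf : ∀ b, 0 ≤ f b) :
    ∑ a ∈ S, (if g a ∈ T then f (g a) else 0) ≤ ∑ b ∈ T, f b := by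
  rw [← Finset.sum_filter, ← Finset.sum_image (f := f) (g := g) (fun a _ b _ h => hg h)]
  refine Finset.sum_le_sum_of_subset_of_nonneg (fun b hb => ?_) fun b _ _ => hf b
  obtain ⟨a, ha, rfl⟩ := Finset.mem_image.1 hb
  exact (Finset.mem_filter.1 ha).2

/-- The multi-index of the neighbour of the cell `c` in the negative `j`-th direction. -/
def prevCell {d : ℕ} (c : Fin d → ℤ) (j : Fin d) : Fin d → ℤ :=
  Function.update c j (c j - 1)

theorem nextCell_prevCell {d : ℕ} (c : Fin d → ℤ) (j : Fin d) :
    nextCell (prevCell c j) j = c := by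
  simp [nextCell, prevCell]

theorem prevCell_nextCell {d : ℕ} (c : Fin d → ℤ) (j : Fin d) :
    prevCell (nextCell c j) j = c := by
  simp [nextCell, prevCell]

theorem nextCell_injective {d : ℕ} (j : Fin d) :
    Function.Injective fun c : Fin d → ℤ => nextCell c j :=
  Function.LeftInverse.injective (g := fun c => prevCell c j) fun c => prevCell_nextCell c j

theorem prevCell_injective {d : ℕ} (j : Fin d) :
    Function.Injective fun c : Fin d → ℤ => prevCell c j :=
  Function.LeftInverse.injective (g := fun c => nextCell c j) fun c => nextCell_prevCell c j

theorem volume_gridCell_inter {d : ℕ} {o : Fin d → ℝ} {h : ℝ} (hh : 0 < h) {c c' : Fin d → ℤ}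
    (hne : c ≠ c') : volume (gridCell o h c ∩ gridCell o h c') = 0 := by
  have main : ∀ c c' : Fin d → ℤ, ∀ i, c i < c' i →
      volume (gridCell o h c ∩ gridCell o h c') = 0 := by
    intro c c' i hi
    refine measure_mono_null (fun x hx => ?_)
      (Measure.pi_hyperplane (fun _ : Fin d => (volume : Measure ℝ)) i (o i + h * (c' i : ℝ)))
    have h1 := (hx.1 i).2
    have h2 := (hx.2 i).1
    have h3 : (c i : ℝ) + 1 ≤ c' i := by exact_mod_cast hi
    exact le_antisymm (by nlinarith) h2
  obtain ⟨i, hi⟩ := Function.ne_iff.1 hne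
  rcases lt_or_gt_of_ne hi with hi | hi
  · exact main c c' i hi
  · rw [Set.inter_comm]; exact main c' c i hi

/-- Lets a continuous function that vanishes almost everywhere on a cell vanish on its boundary too.
-/
theorem gridCell_subset_closure_interior {d : ℕ} {o : Fin d → ℝ} {h : ℝ} (hh : 0 < h)
    (c : Fin d → ℤ) : gridCell o h c ⊆ closure (interior (gridCell o h c)) := by
  rw [gridCell_eq_Icc, ← Set.pi_univ_Icc, interior_pi_set Set.finite_univ, closure_pi_set]
  intro x hx i hi
  exact (closure_interior_Icc (by nlinarith)).ge (hx i hi)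

theorem isPreconnected_gridCell {d : ℕ} (o : Fin d → ℝ) (h : ℝ) (c : Fin d → ℤ) :
    IsPreconnected (gridCell o h c) := by
  rw [gridCell_eq_Icc]
  exact (convex_Icc _ _).isPreconnected

/-! ### Propagation from uncut cells to the whole mesh, and the two norm bounds -/

namespace ImmersedDomain

variable {d : ℕ} {D : ImmersedDomain d} {p : ℕ}

theorem isCompact_meshDomain : IsCompact D.meshDomain :=
  D.cells.isCompact_biUnion fun c _ => isCompact_gridCell D.o D.h c

theorem integrableOn_mul {u v : (Fin d → ℝ) → ℝ} (hu : u ∈ D.feSpace p) (hv : v ∈ D.feSpace p)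
    {X : Set (Fin d → ℝ)} (hX : X ⊆ D.meshDomain) : IntegrableOn (fun x => u x * v x) X :=
  ((hu.1.mul hv.1).integrableOn_compact isCompact_meshDomain).mono_set hX

theorem integrableOn_sq {v : (Fin d → ℝ) → ℝ} (hv : v ∈ D.feSpace p)
    {X : Set (Fin d → ℝ)} (hX : X ⊆ D.meshDomain) : IntegrableOn (fun x => v x ^ 2) X := by
  simpa only [sq] using integrableOn_mul hv hv hX

theorem integral_biUnion_cell {T : Finset (Fin d → ℤ)} {f : (Fin d → ℝ) → ℝ}
    (hf : IntegrableOn f (⋃ c ∈ T, D.cell c)) :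
    ∫ x in ⋃ c ∈ T, D.cell c, f x = ∑ c ∈ T, ∫ x in D.cell c, f x := by
  have e : ⋃ c ∈ T, D.cell c = ⋃ c : T, D.cell c.1 := Set.biUnion_eq_iUnion _ _
  rw [e] at hf ⊢
  rw [integral_iUnion_ae (fun c => (measurableSet_cell _).nullMeasurableSet) _ hf,
    tsum_fintype, ← Finset.sum_coe_sort T]
  intro c c' hne
  exact volume_gridCell_inter D.h_pos fun h => hne (Subtype.ext h)

theorem l2Inner_self (X : Set (Fin d → ℝ)) (v : (Fin d → ℝ) → ℝ) :
    l2Inner X v v = ∫ x in X, v x ^ 2 := by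
  simp only [l2Inner, sq]

theorem l2Inner_meshDomain {v : (Fin d → ℝ) → ℝ} (hv : v ∈ D.feSpace p) :
    l2Inner D.meshDomain v v = ∑ c ∈ D.cells, D.cellEnergy v c := by
  rw [l2Inner_self]
  exact integral_biUnion_cell (integrableOn_sq hv subset_rfl)

theorem l2Inner_mono {v : (Fin d → ℝ) → ℝ} (hv : v ∈ D.feSpace p) {X Y : Set (Fin d → ℝ)}
    (hXY : X ⊆ Y) (hY : Y ⊆ D.meshDomain) : l2Inner X v v ≤ l2Inner Y v v := by
  rw [l2Inner_self, l2Inner_self]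
  exact setIntegral_mono_set (integrableOn_sq hv hY)
    (Filter.Eventually.of_forall fun x => sq_nonneg _) hXY.eventuallyLE

/-- A cell missing ∂Ω is covered by the disjoint open sets Ω and the complement of the closure of Ω.
It is connected and meets Ω, so it lies in Ω. -/
theorem cell_subset_Ω {c : Fin d → ℤ} (hc : c ∈ D.cells) (hcut : c ∉ D.cutCells) :
    D.cell c ⊆ D.Ω := by
  have hdis : D.cell c ∩ frontier D.Ω = ∅ := by
    simpa [cutCells, hc, Set.not_nonempty_iff_eq_empty] using hcut
  refine IsPreconnected.subset_left_of_subset_union D.isOpen_Ω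
    (isClosed_closure (s := D.Ω)).isOpen_compl
    (Set.disjoint_left.2 fun x hx hx' => hx' (subset_closure hx)) (fun x hx => ?_)
    (D.cell_inter_Ω c hc) (isPreconnected_gridCell _ _ _)
  by_contra hcon
  rw [Set.mem_union, not_or, Set.mem_compl_iff, not_not] at hcon
  have : x ∈ D.cell c ∩ frontier D.Ω :=
    ⟨hx, by rw [D.isOpen_Ω.frontier_eq]; exact ⟨hcon.2, hcon.1⟩⟩
  simp [hdis] at this

variable (D)

open Classical in
/-- The elements from which an uncut element can be reached in at most `n` jumps. -/
def reach : ℕ → Finset (Fin d → ℤ)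
  | 0 => D.cells.filter fun c => c ∉ D.cutCells
  | n + 1 => reach n ∪ D.cutCells.filter fun c => ∃ c' ∈ reach n, ShareFace c c'

variable {D}

theorem cutCells_subset : D.cutCells ⊆ D.cells := by
  classical exact Finset.filter_subset _ _

theorem mem_reach_zero {c : Fin d → ℤ} : c ∈ D.reach 0 ↔ c ∈ D.cells ∧ c ∉ D.cutCells := by
  simp [reach]

theorem mem_reach_succ {n : ℕ} {c : Fin d → ℤ} :
    c ∈ D.reach (n + 1) ↔
      c ∈ D.reach n ∨ c ∈ D.cutCells ∧ ∃ c' ∈ D.reach n, ShareFace c c' := by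
  simp [reach]

theorem reach_subset (n : ℕ) : D.reach n ⊆ D.cells := by
  induction n with
  | zero => exact fun c hc => (mem_reach_zero.1 hc).1
  | succ n ih =>
    exact fun c hc => (mem_reach_succ.1 hc).elim (fun h => ih h) fun h => cutCells_subset h.1

theorem reach_mono {m n : ℕ} (h : m ≤ n) : D.reach m ⊆ D.reach n :=
  monotone_nat_of_le_succ (f := D.reach) (fun _ _ hc => mem_reach_succ.2 (Or.inl hc)) h

theorem mem_reach_of_path (n : ℕ) (T : ℕ → Fin d → ℤ)
    (hT : ∀ i < n, T i ∈ D.cutCells ∧ ShareFace (T i) (T (i + 1))) (hn : T n ∈ D.cells)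
    (hn' : T n ∉ D.cutCells) : T 0 ∈ D.reach n := by
  induction n generalizing T with
  | zero => exact mem_reach_zero.2 ⟨hn, hn'⟩
  | succ n ih =>
    have h1 := ih (fun i => T (i + 1)) (fun i hi => hT (i + 1) (by lia)) hn hn'
    exact mem_reach_succ.2 (Or.inr ⟨(hT 0 n.succ_pos).1, _, h1, (hT 0 n.succ_pos).2⟩)

theorem ResolvedWithin.reach_eq {N : ℕ} (hN : D.ResolvedWithin N) : D.reach N = D.cells := by
  refine (reach_subset N).antisymm fun c hc => ?_
  by_cases hcut : c ∈ D.cutCells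
  · obtain ⟨n, hn, T, rfl, hT, h1, h2⟩ := hN c hcut
    exact reach_mono hn (mem_reach_of_path n T hT h1 h2)
  · exact reach_mono N.zero_le (mem_reach_zero.2 ⟨hc, hcut⟩)

theorem mem_cutFaces {c : Fin d → ℤ} {j : Fin d} :
    (c, j) ∈ D.cutFaces ↔ c ∈ D.cells ∧ nextCell c j ∈ D.cells ∧
      (c ∈ D.cutCells ∨ nextCell c j ∈ D.cutCells) := by
  simp [cutFaces]

theorem one_le_weightL {C : ℝ} (hC : 1 ≤ C) {w : ℕ → ℝ} (hw : ∀ k ∈ Finset.Icc 1 p, 0 < w k) :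
    1 ≤ weightL C p w :=
  le_add_of_le_of_nonneg hC (Finset.sum_nonneg fun k hk => (one_div_pos.2 (hw k hk)).le)

-- The right side lists all neighbours and faces of `c`, with the value 0 where they are not
-- admissible. No neighbour has to be chosen, and the sum over `c` can be estimated by shifting
-- indices.
open Classical in
theorem cellEnergy_le_of_mem_reach_succ {C : ℝ} (hC : 1 ≤ C) (hN : IsNeighbourConst d p C)
    {w : ℕ → ℝ} (hw : ∀ k ∈ Finset.Icc 1 p, 0 < w k) {v : (Fin d → ℝ) → ℝ}
    (hv : v ∈ D.feSpace p) {n : ℕ} {c : Fin d → ℤ} (hc : c ∈ D.reach (n + 1)) :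
    D.cellEnergy v c ≤ weightL C p w * ((if c ∈ D.reach n then D.cellEnergy v c else 0) +
      ∑ j, (((if nextCell c j ∈ D.reach n then D.cellEnergy v (nextCell c j) else 0) +
        (if prevCell c j ∈ D.reach n then D.cellEnergy v (prevCell c j) else 0)) +
        ((if (c, j) ∈ D.cutFaces then D.faceEnergy p w v (c, j) else 0) +
        (if (prevCell c j, j) ∈ D.cutFaces then D.faceEnergy p w v (prevCell c j, j) else 0)))) := by
  have hL := one_le_weightL hC hw
  have hite : ∀ (P : Prop) [Decidable P] (x : ℝ), 0 ≤ x → 0 ≤ if P then x else 0 :=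
    fun P _ x hx => by split_ifs <;> simp [hx]
  have hE := cellEnergy_nonneg (D := D) v
  have hF := faceEnergy_nonneg (D := D) hw v
  have hterm : ∀ j, 0 ≤ ((if nextCell c j ∈ D.reach n then D.cellEnergy v (nextCell c j) else 0) +
        (if prevCell c j ∈ D.reach n then D.cellEnergy v (prevCell c j) else 0)) +
        ((if (c, j) ∈ D.cutFaces then D.faceEnergy p w v (c, j) else 0) +
        (if (prevCell c j, j) ∈ D.cutFaces then D.faceEnergy p w v (prevCell c j, j) else 0)) :=
    fun j => add_nonneg (add_nonneg (hite _ _ (hE _)) (hite _ _ (hE _)))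
      (add_nonneg (hite _ _ (hF _)) (hite _ _ (hF _)))
  by_cases hcn : c ∈ D.reach n
  · rw [if_pos hcn]
    have hs := Finset.sum_nonneg fun j (_ : j ∈ Finset.univ) => hterm j
    refine le_trans ?_ (le_mul_of_one_le_left (add_nonneg (hE c) hs) hL)
    exact le_add_of_nonneg_right hs
  · rw [mem_reach_succ, or_iff_right hcn] at hc
    obtain ⟨hcut, c', hc', j, hj⟩ := hc
    have hcc := cutCells_subset hcut
    have hcc' := reach_subset n hc'
    rw [if_neg hcn, zero_add]
    have hsingle := Finset.single_le_sum (fun j _ => hterm j) (Finset.mem_univ j)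
    have aux : D.cellEnergy v c ≤ weightL C p w *
        (((if nextCell c j ∈ D.reach n then D.cellEnergy v (nextCell c j) else 0) +
        (if prevCell c j ∈ D.reach n then D.cellEnergy v (prevCell c j) else 0)) +
        ((if (c, j) ∈ D.cutFaces then D.faceEnergy p w v (c, j) else 0) +
        (if (prevCell c j, j) ∈ D.cutFaces then D.faceEnergy p w v (prevCell c j, j) else 0))) := by
      rcases hj with rfl | rfl
      · have key := (cellEnergy_le_of_face (zero_lt_one.trans_le hC) hN hw hv hcc hcc').2
        refine key.trans (mul_le_mul_of_nonneg_left ?_ (zero_le_one.trans hL))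
        rw [if_pos hc', if_pos (mem_cutFaces.2 ⟨hcc, hcc', Or.inl hcut⟩)]
        exact add_le_add (le_add_of_nonneg_right (hite _ _ (hE _)))
          (le_add_of_nonneg_right (hite _ _ (hF _)))
      · have key := (cellEnergy_le_of_face (zero_lt_one.trans_le hC) hN hw hv hcc' hcc).1
        refine key.trans (mul_le_mul_of_nonneg_left ?_ (zero_le_one.trans hL))
        rw [prevCell_nextCell, if_pos hc', if_pos (mem_cutFaces.2 ⟨hcc', hcc, Or.inr hcut⟩)]
        exact add_le_add (le_add_of_nonneg_left (hite _ _ (hE _)))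
          (le_add_of_nonneg_left (hite _ _ (hF _)))
    exact aux.trans (mul_le_mul_of_nonneg_left hsingle (zero_le_one.trans hL))

/-- Shifts of cells are injective, so each cell of the smaller layer is counted at most 2d + 1 times
(by itself and its neighbours) and each stabilized face at most twice (from its two sides). -/
theorem sum_reach_succ_le {C : ℝ} (hC : 1 ≤ C) (hN : IsNeighbourConst d p C)
    {w : ℕ → ℝ} (hw : ∀ k ∈ Finset.Icc 1 p, 0 < w k) {v : (Fin d → ℝ) → ℝ}
    (hv : v ∈ D.feSpace p) (n : ℕ) :
    ∑ c ∈ D.reach (n + 1), D.cellEnergy v c ≤ weightL C p w *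
      ((2 * d + 1) * ∑ c ∈ D.reach n, D.cellEnergy v c + 2 * D.stab p w v v) := by
  classical
  have hL := one_le_weightL hC hw
  have hE := cellEnergy_nonneg (D := D) v
  have hF := faceEnergy_nonneg (D := D) hw v
  refine (Finset.sum_le_sum fun c hc => cellEnergy_le_of_mem_reach_succ hC hN hw hv hc).trans ?_
  rw [← Finset.mul_sum]
  refine mul_le_mul_of_nonneg_left ?_ (zero_le_one.trans hL)
  simp only [Finset.sum_add_distrib]
  set S := D.reach (n + 1)
  have h0 := sum_ite_comp_le S (D.reach n) Function.injective_id hE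
  have h1 : ∑ c ∈ S, ∑ j, (if nextCell c j ∈ D.reach n then D.cellEnergy v (nextCell c j) else 0)
      ≤ d * ∑ c ∈ D.reach n, D.cellEnergy v c := by
    rw [Finset.sum_comm]
    refine (Finset.sum_le_sum fun j _ => sum_ite_comp_le S (D.reach n) (nextCell_injective j)
      hE).trans ?_
    simp
  have h2 : ∑ c ∈ S, ∑ j, (if prevCell c j ∈ D.reach n then D.cellEnergy v (prevCell c j) else 0)
      ≤ d * ∑ c ∈ D.reach n, D.cellEnergy v c := by
    rw [Finset.sum_comm]
    refine (Finset.sum_le_sum fun j _ => sum_ite_comp_le S (D.reach n) (prevCell_injective j)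
      hE).trans ?_
    simp
  have h3 : ∑ c ∈ S, ∑ j, (if (c, j) ∈ D.cutFaces then D.faceEnergy p w v (c, j) else 0)
      ≤ D.stab p w v v := by
    rw [← Finset.sum_product']
    exact sum_ite_comp_le (S ×ˢ Finset.univ) D.cutFaces Function.injective_id hF
  have h4 : ∑ c ∈ S, ∑ j, (if (prevCell c j, j) ∈ D.cutFaces then
      D.faceEnergy p w v (prevCell c j, j) else 0) ≤ D.stab p w v v := by
    rw [← Finset.sum_product']
    refine sum_ite_comp_le (S ×ˢ Finset.univ) D.cutFaces
      (g := fun F : (Fin d → ℤ) × Fin d => (prevCell F.1 F.2, F.2)) ?_ hF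
    rintro ⟨c, j⟩ ⟨c', j'⟩ h
    obtain ⟨h, rfl⟩ := Prod.mk.inj h
    exact Prod.ext (prevCell_injective j h) rfl
  simp only [id] at h0
  linarith

theorem stab_self_nonneg {w : ℕ → ℝ} (hw : ∀ k ∈ Finset.Icc 1 p, 0 < w k)
    (v : (Fin d → ℝ) → ℝ) : 0 ≤ D.stab p w v v :=
  Finset.sum_nonneg fun F _ => faceEnergy_nonneg hw v F

theorem l2Inner_self_nonneg (X : Set (Fin d → ℝ)) (v : (Fin d → ℝ) → ℝ) : 0 ≤ l2Inner X v v :=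
  integral_nonneg fun _ => mul_self_nonneg _

theorem sum_uncut_le {v : (Fin d → ℝ) → ℝ} (hv : v ∈ D.feSpace p) :
    ∑ c ∈ D.reach 0, D.cellEnergy v c ≤ l2Inner D.Ω v v := by
  have hsub : ⋃ c ∈ D.reach 0, D.cell c ⊆ D.Ω := Set.iUnion₂_subset fun c hc =>
    cell_subset_Ω (mem_reach_zero.1 hc).1 (mem_reach_zero.1 hc).2
  refine le_trans (le_of_eq ?_) (l2Inner_mono hv hsub D.Ω_subset)
  rw [l2Inner_self]
  exact (integral_biUnion_cell (integrableOn_sq hv (hsub.trans D.Ω_subset))).symm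

theorem sum_reach_le {C : ℝ} (hC : 1 ≤ C) (hN : IsNeighbourConst d p C)
    {w : ℕ → ℝ} (hw : ∀ k ∈ Finset.Icc 1 p, 0 < w k) {v : (Fin d → ℝ) → ℝ}
    (hv : v ∈ D.feSpace p) (n : ℕ) :
    ∑ c ∈ D.reach n, D.cellEnergy v c ≤ (2 * d + 3) ^ n * weightL C p w ^ n *
      (l2Inner D.Ω v v + D.stab p w v v) := by
  have hL := one_le_weightL hC hw
  have hJ := stab_self_nonneg (D := D) hw v
  have hO := l2Inner_self_nonneg D.Ω v
  induction n with
  | zero => simpa using (sum_uncut_le hv).trans (le_add_of_nonneg_right hJ)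
  | succ n ih =>
    set X := l2Inner D.Ω v v + D.stab p w v v with hX
    have hX0 : 0 ≤ X := add_nonneg hO hJ
    -- The accumulated factor is at least 1, so the stabilization is absorbed into the same bound;
    -- then (2d + 1) + 2 = 2d + 3.
    have hK : (1 : ℝ) ≤ (2 * d + 3) ^ n * weightL C p w ^ n :=
      one_le_mul_of_one_le_of_one_le (one_le_pow₀ (by linarith [Nat.cast_nonneg (α := ℝ) d]))
        (one_le_pow₀ hL)
    have hJX : D.stab p w v v ≤ (2 * d + 3) ^ n * weightL C p w ^ n * X :=
      (le_add_of_nonneg_left hO).trans (le_mul_of_one_le_left hX0 hK)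
    refine (sum_reach_succ_le hC hN hw hv n).trans ?_
    calc _ ≤ weightL C p w * ((2 * d + 1) * ((2 * d + 3) ^ n * weightL C p w ^ n * X) +
          2 * ((2 * d + 3) ^ n * weightL C p w ^ n * X)) := by gcongr
      _ = _ := by ring

/-- The stabilized form controls the `L²` norm on the whole background mesh. -/
theorem l2Inner_meshDomain_le {C : ℝ} (hC : 1 ≤ C) (hN : IsNeighbourConst d p C)
    {w : ℕ → ℝ} (hw : ∀ k ∈ Finset.Icc 1 p, 0 < w k) {v : (Fin d → ℝ) → ℝ}
    (hv : v ∈ D.feSpace p) {N : ℕ} (hD : D.ResolvedWithin N) {γ : ℝ} (hγ : 0 < γ) :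
    l2Inner D.meshDomain v v ≤ (2 * d + 3) ^ N * max 1 (1 / γ) * weightL C p w ^ N *
      D.massForm p w γ v v := by
  have hL := one_le_weightL hC hw
  have hJ := stab_self_nonneg (D := D) hw v
  have hO := l2Inner_self_nonneg D.Ω v
  rw [l2Inner_meshDomain hv, ← hD.reach_eq]
  refine (sum_reach_le hC hN hw hv N).trans ?_
  have h1 : l2Inner D.Ω v v + D.stab p w v v ≤ max 1 (1 / γ) * D.massForm p w γ v v := by
    rw [massForm, mul_add]
    refine add_le_add (le_mul_of_one_le_left hO (le_max_left _ _)) ?_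
    calc D.stab p w v v = 1 / γ * (γ * D.stab p w v v) := by field_simp
      _ ≤ _ := mul_le_mul_of_nonneg_right (le_max_right _ _) (by positivity)
  calc _ ≤ (2 * d + 3) ^ N * weightL C p w ^ N * (max 1 (1 / γ) * D.massForm p w γ v v) := by
        gcongr
    _ = _ := by ring

/-- Each cell belongs to at most 2d faces, whence 144 d = 72 · 2d. -/
theorem stab_self_le (hp : 1 ≤ p) {w : ℕ → ℝ} (hw : ∀ k ∈ Finset.Icc 1 p, 0 < w k)
    {v : (Fin d → ℝ) → ℝ} (hv : v ∈ D.feSpace p) :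
    D.stab p w v v ≤ 144 * d * weightG p w * l2Inner D.meshDomain v v := by
  classical
  have hE := cellEnergy_nonneg (D := D) v
  have hG : 0 ≤ weightG p w :=
    Finset.sum_nonneg fun k hk => mul_nonneg (hw k hk).le (by positivity)
  have h1 : ∑ F ∈ D.cutFaces, (D.cellEnergy v F.1 + D.cellEnergy v (nextCell F.1 F.2)) ≤
      2 * d * ∑ c ∈ D.cells, D.cellEnergy v c := by
    have hsub : D.cutFaces ⊆ D.cells ×ˢ Finset.univ := Finset.filter_subset _ _
    calc _ ≤ ∑ F ∈ D.cutFaces, (D.cellEnergy v F.1 +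
          if nextCell F.1 F.2 ∈ D.cells then D.cellEnergy v (nextCell F.1 F.2) else 0) := by
          refine Finset.sum_le_sum fun F hF => ?_
          rw [if_pos (mem_cutFaces.1 hF).2.1]
      _ ≤ ∑ F ∈ D.cells ×ˢ Finset.univ, (D.cellEnergy v F.1 +
          if nextCell F.1 F.2 ∈ D.cells then D.cellEnergy v (nextCell F.1 F.2) else 0) := by
          refine Finset.sum_le_sum_of_subset_of_nonneg hsub fun F _ _ => add_nonneg (hE _) ?_
          split_ifs <;> simp [hE]
      _ ≤ d * ∑ c ∈ D.cells, D.cellEnergy v c + d * ∑ c ∈ D.cells, D.cellEnergy v c := by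
          rw [Finset.sum_add_distrib]
          refine add_le_add (le_of_eq ?_) ?_
          · rw [Finset.sum_product]; simp [Finset.mul_sum]
          · rw [Finset.sum_product, Finset.sum_comm]
            refine (Finset.sum_le_sum fun j _ => sum_ite_comp_le D.cells D.cells
              (nextCell_injective j) hE).trans ?_
            simp
      _ = _ := by ring
  rw [l2Inner_meshDomain hv, stab_self]
  calc _ ≤ ∑ F ∈ D.cutFaces, 72 * weightG p w *
        (D.cellEnergy v F.1 + D.cellEnergy v (nextCell F.1 F.2)) :=
        Finset.sum_le_sum fun F hF =>
          faceEnergy_le hp hw hv (mem_cutFaces.1 hF).1 (mem_cutFaces.1 hF).2.1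
    _ ≤ 72 * weightG p w * (2 * d * ∑ c ∈ D.cells, D.cellEnergy v c) := by
        rw [← Finset.mul_sum]
        exact mul_le_mul_of_nonneg_left h1 (by positivity)
    _ = _ := by ring

theorem massForm_self_le (hp : 1 ≤ p) {w : ℕ → ℝ} (hw : ∀ k ∈ Finset.Icc 1 p, 0 < w k)
    {v : (Fin d → ℝ) → ℝ} (hv : v ∈ D.feSpace p) {γ : ℝ} (hγ : 0 < γ) :
    D.massForm p w γ v v ≤ (1 + 144 * d * γ * weightG p w) * l2Inner D.meshDomain v v := by
  have h1 : l2Inner D.Ω v v ≤ l2Inner D.meshDomain v v :=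
    l2Inner_mono hv D.Ω_subset subset_rfl
  have h2 := mul_le_mul_of_nonneg_left (stab_self_le hp hw hv) hγ.le
  rw [massForm]
  linarith

/-- Zero energy forces v = 0 almost everywhere, hence everywhere, on each cell; off the mesh v is 0
by the convention in `feSpace`. -/
theorem l2Inner_meshDomain_pos {v : (Fin d → ℝ) → ℝ} (hv : v ∈ D.feSpace p) (hv0 : v ≠ 0) :
    0 < l2Inner D.meshDomain v v := by
  refine lt_of_le_of_ne (l2Inner_self_nonneg _ _) fun h0 => hv0 (funext fun x => ?_)
  by_cases hx : x ∈ D.meshDomain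
  · obtain ⟨c, hc, hxc⟩ := Set.mem_iUnion₂.1 hx
    rw [l2Inner_meshDomain hv, eq_comm,
      Finset.sum_eq_zero_iff_of_nonneg fun c _ => cellEnergy_nonneg v c] at h0
    obtain ⟨q, hq⟩ := exists_isLocalPoly hv hc
    have h1 := h0 c hc
    have cq : Continuous fun x => MvPolynomial.eval x q ^ 2 :=
      (MvPolynomial.continuous_eval q).pow 2
    rw [cellEnergy_eq hq, setIntegral_eq_zero_iff_of_nonneg_ae
      (Filter.Eventually.of_forall fun x => sq_nonneg _)
      (cq.continuousOn.integrableOn_compact (isCompact_gridCell _ _ _))] at h1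
    have h2 := Measure.eqOn_of_ae_eq h1 cq.continuousOn continuousOn_const
      (gridCell_subset_closure_interior D.h_pos c) hxc
    rw [hq.eq_eval x hxc]
    exact pow_eq_zero_iff two_ne_zero |>.1 h2
  · exact hv.2.1 x hx

end ImmersedDomain

/-! ### Bilinearity of the forms on the finite element space -/

section FaceDerivLinear

variable {d : ℕ} {o : Fin d → ℝ} {h : ℝ} {c : Fin d → ℤ} {j : Fin d}

theorem faceDeriv_add (k : ℕ) (q r : MvPolynomial (Fin d) ℝ) (y : {i : Fin d // i ≠ j} → ℝ) :
    faceDeriv o h c j k (q + r) y = faceDeriv o h c j k q y + faceDeriv o h c j k r y := by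
  simp [faceDeriv, slice]

theorem faceDeriv_C_mul (k : ℕ) (a : ℝ) (q : MvPolynomial (Fin d) ℝ)
    (y : {i : Fin d // i ≠ j} → ℝ) :
    faceDeriv o h c j k (MvPolynomial.C a * q) y = a * faceDeriv o h c j k q y := by
  simp [faceDeriv, slice, Polynomial.iterate_derivative_C_mul]

end FaceDerivLinear

namespace ImmersedDomain

variable {d : ℕ} {D : ImmersedDomain d} {p : ℕ}

theorem IsLocalPoly.add {u v : (Fin d → ℝ) → ℝ} {c : Fin d → ℤ} {q r : MvPolynomial (Fin d) ℝ}
    (hq : D.IsLocalPoly p u c q) (hr : D.IsLocalPoly p v c r) :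
    D.IsLocalPoly p (u + v) c (q + r) where
  degreeOf_le i := (MvPolynomial.degreeOf_add_le i q r).trans
    (max_le (hq.degreeOf_le i) (hr.degreeOf_le i))
  eq_eval x hx := by simp [hq.eq_eval x hx, hr.eq_eval x hx]

theorem IsLocalPoly.smul {v : (Fin d → ℝ) → ℝ} {c : Fin d → ℤ} {q : MvPolynomial (Fin d) ℝ}
    (hq : D.IsLocalPoly p v c q) (a : ℝ) :
    D.IsLocalPoly p (a • v) c (MvPolynomial.C a * q) where
  degreeOf_le i := (MvPolynomial.degreeOf_C_mul_le q i a).trans (hq.degreeOf_le i)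
  eq_eval x hx := by simp [hq.eq_eval x hx]

theorem l2Inner_comm (X : Set (Fin d → ℝ)) (u v : (Fin d → ℝ) → ℝ) :
    l2Inner X u v = l2Inner X v u := by
  simp only [l2Inner, mul_comm]

theorem l2Inner_add_left {X : Set (Fin d → ℝ)} (hX : X ⊆ D.meshDomain)
    {u u' v : (Fin d → ℝ) → ℝ} (hu : u ∈ D.feSpace p) (hu' : u' ∈ D.feSpace p)
    (hv : v ∈ D.feSpace p) : l2Inner X (u + u') v = l2Inner X u v + l2Inner X u' v := by
  simp only [l2Inner, Pi.add_apply, add_mul]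
  exact integral_add (integrableOn_mul hu hv hX) (integrableOn_mul hu' hv hX)

theorem l2Inner_smul_left (X : Set (Fin d → ℝ)) (a : ℝ) (u v : (Fin d → ℝ) → ℝ) :
    l2Inner X (a • u) v = a * l2Inner X u v := by
  simp only [l2Inner, Pi.smul_apply, smul_eq_mul, mul_assoc, integral_const_mul]

theorem stab_comm (w : ℕ → ℝ) (u v : (Fin d → ℝ) → ℝ) : D.stab p w u v = D.stab p w v u := by
  simp only [stab, mul_comm (D.jump _ _ _ u _)]

/-- Neither `iteratedDerivWithin` nor the integral is additive on arbitrary functions, so the jumps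
are first expressed by the local polynomials. -/
theorem stab_add_left (w : ℕ → ℝ) {u u' v : (Fin d → ℝ) → ℝ} (hu : u ∈ D.feSpace p)
    (hu' : u' ∈ D.feSpace p) (hv : v ∈ D.feSpace p) :
    D.stab p w (u + u') v = D.stab p w u v + D.stab p w u' v := by
  simp only [stab, ← Finset.sum_add_distrib]
  refine Finset.sum_congr rfl fun F hF => Finset.sum_congr rfl fun k _ => ?_
  obtain ⟨hc, hc', -⟩ := mem_cutFaces.1 hF
  obtain ⟨q, hq⟩ := exists_isLocalPoly hu hc
  obtain ⟨r, hr⟩ := exists_isLocalPoly hu hc'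
  obtain ⟨q₁, hq₁⟩ := exists_isLocalPoly hu' hc
  obtain ⟨r₁, hr₁⟩ := exists_isLocalPoly hu' hc'
  obtain ⟨q₂, hq₂⟩ := exists_isLocalPoly hv hc
  obtain ⟨r₂, hr₂⟩ := exists_isLocalPoly hv hc'
  rw [faceIntegral_jump_mul_jump (hq.add hq₁) (hr.add hr₁) hq₂ hr₂,
    faceIntegral_jump_mul_jump hq hr hq₂ hr₂, faceIntegral_jump_mul_jump hq₁ hr₁ hq₂ hr₂,
    ← mul_add]
  have hcont : ∀ s : MvPolynomial (Fin d) ℝ, Continuous (faceDeriv D.o D.h F.1 F.2 k s) :=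
    continuous_faceDeriv k
  have hint : ∀ s t : MvPolynomial (Fin d) ℝ, IntegrableOn (fun y =>
      (faceDeriv D.o D.h F.1 F.2 k s y - faceDeriv D.o D.h F.1 F.2 k t y) *
        (faceDeriv D.o D.h F.1 F.2 k r₂ y - faceDeriv D.o D.h F.1 F.2 k q₂ y))
      (faceBox D.o D.h F.1 F.2) := fun s t =>
    (((hcont s).sub (hcont t)).mul ((hcont r₂).sub (hcont q₂))).integrableOn_faceBox
  rw [← integral_add (hint r q) (hint r₁ q₁)]
  congr 2
  ext y
  simp only [faceDeriv_add]
  ring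

theorem stab_smul_left (w : ℕ → ℝ) (a : ℝ) {u v : (Fin d → ℝ) → ℝ} (hu : u ∈ D.feSpace p)
    (hv : v ∈ D.feSpace p) : D.stab p w (a • u) v = a * D.stab p w u v := by
  simp only [stab, Finset.mul_sum]
  refine Finset.sum_congr rfl fun F hF => Finset.sum_congr rfl fun k _ => ?_
  obtain ⟨hc, hc', -⟩ := mem_cutFaces.1 hF
  obtain ⟨q, hq⟩ := exists_isLocalPoly hu hc
  obtain ⟨r, hr⟩ := exists_isLocalPoly hu hc'
  obtain ⟨q₂, hq₂⟩ := exists_isLocalPoly hv hc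
  obtain ⟨r₂, hr₂⟩ := exists_isLocalPoly hv hc'
  rw [faceIntegral_jump_mul_jump (hq.smul a) (hr.smul a) hq₂ hr₂,
    faceIntegral_jump_mul_jump hq hr hq₂ hr₂, mul_left_comm a, ← integral_const_mul a]
  congr 2
  ext y
  simp only [faceDeriv_C_mul]
  ring

theorem massForm_comm (w : ℕ → ℝ) (γ : ℝ) (u v : (Fin d → ℝ) → ℝ) :
    D.massForm p w γ u v = D.massForm p w γ v u := by
  rw [massForm, massForm, l2Inner_comm, stab_comm]

variable (D) in
/-- The `L²` scalar product over the background mesh, as a bilinear form. -/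
def meshBilin (p : ℕ) : LinearMap.BilinForm ℝ (D.feSpace p) :=
  LinearMap.mk₂ ℝ (fun u v => l2Inner D.meshDomain u v)
    (fun u u' v => l2Inner_add_left subset_rfl u.2 u'.2 v.2)
    (fun a u v => l2Inner_smul_left _ a (u : (Fin d → ℝ) → ℝ) v)
    (fun u v v' => by
      simp only [l2Inner_comm _ (u : (Fin d → ℝ) → ℝ)]
      exact l2Inner_add_left subset_rfl v.2 v'.2 u.2)
    (fun a u v => by
      simp only [l2Inner_comm _ (u : (Fin d → ℝ) → ℝ)]
      exact l2Inner_smul_left _ a (v : (Fin d → ℝ) → ℝ) u)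

theorem massForm_add_left (w : ℕ → ℝ) (γ : ℝ) {u u' v : (Fin d → ℝ) → ℝ}
    (hu : u ∈ D.feSpace p) (hu' : u' ∈ D.feSpace p) (hv : v ∈ D.feSpace p) :
    D.massForm p w γ (u + u') v = D.massForm p w γ u v + D.massForm p w γ u' v := by
  rw [massForm, massForm, massForm, l2Inner_add_left D.Ω_subset hu hu' hv,
    stab_add_left w hu hu' hv]
  ring

theorem massForm_smul_left (w : ℕ → ℝ) (γ a : ℝ) {u v : (Fin d → ℝ) → ℝ}
    (hu : u ∈ D.feSpace p) (hv : v ∈ D.feSpace p) :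
    D.massForm p w γ (a • u) v = a * D.massForm p w γ u v := by
  rw [massForm, massForm, l2Inner_smul_left, stab_smul_left w a hu hv]
  ring

variable (D) in
/-- The stabilized scalar product as a bilinear form. -/
def massBilin (p : ℕ) (w : ℕ → ℝ) (γ : ℝ) : LinearMap.BilinForm ℝ (D.feSpace p) :=
  LinearMap.mk₂ ℝ (fun u v => D.massForm p w γ u v)
    (fun u u' v => massForm_add_left w γ u.2 u'.2 v.2)
    (fun a u v => massForm_smul_left w γ a u.2 v.2)
    (fun u v v' => by
      simp only [massForm_comm w γ (u : (Fin d → ℝ) → ℝ)]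
      exact massForm_add_left w γ v.2 v'.2 u.2)
    (fun a u v => by
      simp only [massForm_comm w γ (u : (Fin d → ℝ) → ℝ)]
      exact massForm_smul_left w γ a v.2 u.2)

end ImmersedDomain

/-! ### Condition numbers of spectrally equivalent matrices -/

section Matrices

open Matrix

variable {ι : Type*} [Fintype ι] [DecidableEq ι]

theorem posDef_toMatrix {V : Type*} [AddCommGroup V] [Module ℝ V] (b : Module.Basis ι ℝ V)
    {B : LinearMap.BilinForm ℝ V} (hs : ∀ u v, B u v = B v u) (hpos : ∀ v, v ≠ 0 → 0 < B v v) :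
    (LinearMap.BilinForm.toMatrix b B).PosDef := by
  refine PosDef.of_dotProduct_mulVec_pos ?_ fun x hx => ?_
  · ext i j
    simp [LinearMap.BilinForm.toMatrix_apply, hs (b i)]
  · rw [star_trivial, LinearMap.BilinForm.dotProduct_toMatrix_mulVec]
    exact hpos _ ((LinearEquiv.map_ne_zero_iff _).2 hx)

theorem PosDef.dotProduct_mulVec_sq_le {A : Matrix ι ι ℝ} (hA : A.PosDef) (x y : ι → ℝ) :
    (x ⬝ᵥ A *ᵥ y) ^ 2 ≤ (x ⬝ᵥ A *ᵥ x) * (y ⬝ᵥ A *ᵥ y) := by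
  have hsymm : Aᵀ = A := by simpa using hA.isHermitian.eq
  have h := LinearMap.BilinForm.apply_sq_le_of_symm (Matrix.toBilin' A)
    (fun x => by
      rw [Matrix.toBilin'_apply']
      simpa using hA.posSemidef.dotProduct_mulVec_nonneg x)
    ⟨fun x y => by
      simp only [Matrix.toBilin'_apply', RingHom.id_apply]
      rw [dotProduct_mulVec, ← mulVec_transpose, hsymm, dotProduct_comm]⟩ x y
  simpa only [Matrix.toBilin'_apply'] using h

theorem dotProduct_mulVec_le_norm (A : Matrix ι ι ℝ) (x : EuclideanSpace ℝ ι) :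
    x.ofLp ⬝ᵥ A *ᵥ x.ofLp ≤ ‖Matrix.toEuclideanCLM (n := ι) (𝕜 := ℝ) A‖ * ‖x‖ ^ 2 := by
  rw [← Matrix.inner_toEuclideanCLM]
  refine (real_inner_le_norm _ _).trans ?_
  calc ‖x‖ * ‖Matrix.toEuclideanCLM (n := ι) (𝕜 := ℝ) A x‖
      ≤ ‖x‖ * (‖Matrix.toEuclideanCLM (n := ι) (𝕜 := ℝ) A‖ * ‖x‖) :=
        mul_le_mul_of_nonneg_left (ContinuousLinearMap.le_opNorm _ _) (norm_nonneg _)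
    _ = _ := by ring

/-- Cauchy–Schwarz for the form of `A`, applied to x and y = A x, gives ‖y‖⁴ ≤ β² ‖x‖² ‖y‖²; no
eigenvalues are needed. -/
theorem PosDef.norm_toEuclideanCLM_le {A : Matrix ι ι ℝ} (hA : A.PosDef) {β : ℝ} (hβ : 0 ≤ β)
    (h : ∀ x : EuclideanSpace ℝ ι, x.ofLp ⬝ᵥ A *ᵥ x.ofLp ≤ β * ‖x‖ ^ 2) :
    ‖Matrix.toEuclideanCLM (n := ι) (𝕜 := ℝ) A‖ ≤ β := by
  refine ContinuousLinearMap.opNorm_le_bound _ hβ fun x => ?_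
  set y := Matrix.toEuclideanCLM (n := ι) (𝕜 := ℝ) A x with hy
  have h1 : y.ofLp ⬝ᵥ A *ᵥ x.ofLp = ‖y‖ ^ 2 := by
    rw [← Matrix.inner_toEuclideanCLM, ← hy, real_inner_self_eq_norm_sq]
  have h2 := PosDef.dotProduct_mulVec_sq_le hA y.ofLp x.ofLp
  rw [h1] at h2
  have h3 : (‖y‖ ^ 2) ^ 2 ≤ (β * ‖x‖ * ‖y‖) ^ 2 := by
    refine h2.trans ((mul_le_mul (h y) (h x) ?_ (by positivity)).trans (le_of_eq (by ring)))
    simpa using hA.posSemidef.dotProduct_mulVec_nonneg x.ofLp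
  have h4 : ‖y‖ ^ 2 ≤ β * ‖x‖ * ‖y‖ := (abs_le_of_sq_le_sq' h3 (by positivity)).2
  rcases (norm_nonneg y).eq_or_lt with h0 | h0
  · rw [← h0]; positivity
  · exact le_of_mul_le_mul_right (by rw [← sq]; exact h4) h0

/-- Inversion reverses the order of forms. With z = A⁻¹ x and u = B⁻¹ x, Cauchy–Schwarz for `B`
gives (z·x)² = (z·B u)² ≤ (z·B z)(u·x) ≤ K (z·x)(u·x), and one factor z·x cancels. -/
theorem PosDef.dotProduct_inv_mulVec_le {A B : Matrix ι ι ℝ} (hA : A.PosDef) (hB : B.PosDef)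
    {K : ℝ} (h : ∀ x : ι → ℝ, x ⬝ᵥ B *ᵥ x ≤ K * (x ⬝ᵥ A *ᵥ x)) (x : ι → ℝ) :
    x ⬝ᵥ A⁻¹ *ᵥ x ≤ K * (x ⬝ᵥ B⁻¹ *ᵥ x) := by
  set z := A⁻¹ *ᵥ x with hz
  set u := B⁻¹ *ᵥ x with hu
  have hAz : A *ᵥ z = x := by
    rw [hz, mulVec_mulVec, mul_nonsing_inv _ ((Matrix.isUnit_iff_isUnit_det _).1 hA.isUnit),
      one_mulVec]
  have hBu : B *ᵥ u = x := by
    rw [hu, mulVec_mulVec, mul_nonsing_inv _ ((Matrix.isUnit_iff_isUnit_det _).1 hB.isUnit),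
      one_mulVec]
  have h1 := PosDef.dotProduct_mulVec_sq_le hB z u
  have h2 := h z
  rw [hBu] at h1
  rw [hAz] at h2
  have h3 : 0 ≤ u ⬝ᵥ x := by
    have := hB.posSemidef.dotProduct_mulVec_nonneg u
    rwa [star_trivial, hBu] at this
  have h4 : 0 ≤ z ⬝ᵥ x := by
    have := hA.posSemidef.dotProduct_mulVec_nonneg z
    rwa [star_trivial, hAz] at this
  have h5 : (z ⬝ᵥ x) ^ 2 ≤ K * (z ⬝ᵥ x) * (u ⬝ᵥ x) :=
    h1.trans (mul_le_mul_of_nonneg_right h2 h3)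
  rw [dotProduct_comm x z, dotProduct_comm x u]
  -- The factor z·x can be cancelled unless it is 0, and then x = 0 because A⁻¹ is positive
  -- definite.
  rcases h4.eq_or_lt with h0 | h0
  · rw [← h0]
    have hz0 : x ⬝ᵥ A⁻¹ *ᵥ x = 0 := by rw [← hz, dotProduct_comm, ← h0]
    have hx0 : x = 0 := by
      by_contra hx
      have := hA.inv.dotProduct_mulVec_pos hx
      rw [star_trivial, hz0] at this
      exact lt_irrefl _ this
    simp [hx0]
  · exact le_of_mul_le_mul_left (by rw [← sq]; exact h5.trans (le_of_eq (by ring))) h0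

/-- Comparison of condition numbers of two spectrally equivalent matrices. -/
theorem condNumber_le_mul_condNumber {A B : Matrix ι ι ℝ} (hA : A.PosDef) (hB : B.PosDef)
    {K β : ℝ} (hK : 0 ≤ K) (hβ : 0 ≤ β)
    (h₁ : ∀ x : ι → ℝ, x ⬝ᵥ B *ᵥ x ≤ K * (x ⬝ᵥ A *ᵥ x))
    (h₂ : ∀ x : ι → ℝ, x ⬝ᵥ A *ᵥ x ≤ β * (x ⬝ᵥ B *ᵥ x)) :
    condNumber A ≤ K * β * condNumber B := by
  have hn : ‖Matrix.toEuclideanCLM (n := ι) (𝕜 := ℝ) A‖ ≤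
      β * ‖Matrix.toEuclideanCLM (n := ι) (𝕜 := ℝ) B‖ :=
    PosDef.norm_toEuclideanCLM_le hA (by positivity) fun x =>
      (h₂ x.ofLp).trans ((mul_le_mul_of_nonneg_left (dotProduct_mulVec_le_norm B x) hβ).trans
        (le_of_eq (by ring)))
  have hi : ‖Matrix.toEuclideanCLM (n := ι) (𝕜 := ℝ) A⁻¹‖ ≤
      K * ‖Matrix.toEuclideanCLM (n := ι) (𝕜 := ℝ) B⁻¹‖ :=
    PosDef.norm_toEuclideanCLM_le hA.inv (by positivity) fun x =>
      (PosDef.dotProduct_inv_mulVec_le hA hB h₁ x.ofLp).trans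
        ((mul_le_mul_of_nonneg_left (dotProduct_mulVec_le_norm B⁻¹ x) hK).trans
          (le_of_eq (by ring)))
  calc condNumber A ≤ (β * ‖Matrix.toEuclideanCLM (n := ι) (𝕜 := ℝ) B‖) *
        (K * ‖Matrix.toEuclideanCLM (n := ι) (𝕜 := ℝ) B⁻¹‖) :=
        mul_le_mul hn hi (norm_nonneg _) (by positivity)
    _ = _ := by rw [condNumber]; ring

end Matrices

/-! ### The mass matrices as matrices of the bilinear forms, and the theorem -/

namespace ImmersedDomain

variable {d : ℕ} {D : ImmersedDomain d} {p : ℕ} {ι : Type*} [Fintype ι] [DecidableEq ι]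

theorem massMatrix_eq_toMatrix (φ : Module.Basis ι ℝ (D.feSpace p)) (w : ℕ → ℝ) (γ : ℝ) :
    D.massMatrix φ w γ = LinearMap.BilinForm.toMatrix φ (D.massBilin p w γ) := by
  ext i j
  rw [LinearMap.BilinForm.toMatrix_apply]
  rfl

theorem meshMassMatrix_eq_toMatrix (φ : Module.Basis ι ℝ (D.feSpace p)) :
    D.meshMassMatrix φ = LinearMap.BilinForm.toMatrix φ (D.meshBilin p) := by
  ext i j
  rw [LinearMap.BilinForm.toMatrix_apply]
  rfl

theorem posDef_meshMassMatrix (φ : Module.Basis ι ℝ (D.feSpace p)) :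
    (D.meshMassMatrix φ).PosDef := by
  rw [meshMassMatrix_eq_toMatrix]
  exact posDef_toMatrix φ (fun u v => l2Inner_comm _ _ _) fun v hv =>
    l2Inner_meshDomain_pos v.2 fun h => hv (Subtype.ext h)

end ImmersedDomain

end CutFEM

end

theorem lemma4 (d : ℕ) (hd : 1 ≤ d) :
    (∀ p : ℕ, ∃ C₁ : ℝ, CutFEM.IsNeighbourConst d p C₁) ∧
    ∀ γ : ℝ, 0 < γ → ∃ Cg : ℝ, 0 < Cg ∧ ∀ NJ : ℕ, ∃ Cl : ℝ, 0 < Cl ∧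
      ∀ p : ℕ, 1 ≤ p → ∀ C₁ : ℝ, CutFEM.IsNeighbourConst d p C₁ →
      ∀ w : ℕ → ℝ, (∀ k ∈ Finset.Icc 1 p, 0 < w k) →
      ∀ D : CutFEM.ImmersedDomain d, D.ResolvedWithin NJ →
      ∀ (ι : Type) [Fintype ι] [DecidableEq ι] (φ : Module.Basis ι ℝ (D.feSpace p)),
        (D.massMatrix φ w γ).PosDef ∧ (D.meshMassMatrix φ).PosDef ∧
        CutFEM.condNumber (D.massMatrix φ w γ) ≤
          Cl * CutFEM.weightL C₁ p w ^ NJ * (1 + Cg * CutFEM.weightG p w) *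
            CutFEM.condNumber (D.meshMassMatrix φ) := by
  have hd0 : (0 : ℝ) < d := by exact_mod_cast hd
  -- `Cg` is the constant of `massForm_self_le`, `Cl` that of `l2Inner_meshDomain_le`; only the
  -- latter involves the number of jumps.
  refine ⟨fun p => CutFEM.exists_isNeighbourConst d p, fun γ hγ =>
    ⟨144 * d * γ, by positivity, fun N =>
    ⟨(2 * d + 3) ^ N * max 1 (1 / γ), by positivity, ?_⟩⟩⟩
  intro p hp C hN w hw D hD ι _ _ φ
  have hC := hN.one_le hd
  have hL := CutFEM.ImmersedDomain.one_le_weightL hC hw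
  have hG : 0 ≤ CutFEM.weightG p w :=
    Finset.sum_nonneg fun k hk => mul_nonneg (hw k hk).le (by positivity)
  have hK : 0 < (2 * d + 3 : ℝ) ^ N * max 1 (1 / γ) * CutFEM.weightL C p w ^ N := by positivity
  have hlow : ∀ v : D.feSpace p, D.meshBilin p v v ≤
      (2 * d + 3 : ℝ) ^ N * max 1 (1 / γ) * CutFEM.weightL C p w ^ N * D.massBilin p w γ v v :=
    fun v => CutFEM.ImmersedDomain.l2Inner_meshDomain_le hC hN hw v.2 hD hγ
  have hup : ∀ v : D.feSpace p, D.massBilin p w γ v v ≤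
      (1 + 144 * d * γ * CutFEM.weightG p w) * D.meshBilin p v v :=
    fun v => CutFEM.ImmersedDomain.massForm_self_le hp hw v.2 hγ
  have hB := CutFEM.ImmersedDomain.posDef_meshMassMatrix φ
  -- Positivity of the stabilized form is inherited from the background L² norm through the lower
  -- bound `hlow`.
  have hA : (D.massMatrix φ w γ).PosDef := by
    rw [CutFEM.ImmersedDomain.massMatrix_eq_toMatrix]
    refine CutFEM.posDef_toMatrix φ
      (fun u v => CutFEM.ImmersedDomain.massForm_comm w γ _ _) fun v hv => ?_
    have h0 : 0 < D.meshBilin p v v :=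
      CutFEM.ImmersedDomain.l2Inner_meshDomain_pos v.2 fun h => hv (Subtype.ext h)
    exact pos_of_mul_pos_right (h0.trans_le (hlow v)) hK.le
  refine ⟨hA, hB, CutFEM.condNumber_le_mul_condNumber hA hB hK.le (by positivity)
    (fun x => ?_) fun x => ?_⟩
  · rw [CutFEM.ImmersedDomain.massMatrix_eq_toMatrix,
      CutFEM.ImmersedDomain.meshMassMatrix_eq_toMatrix,
      LinearMap.BilinForm.dotProduct_toMatrix_mulVec,
      LinearMap.BilinForm.dotProduct_toMatrix_mulVec]
    exact hlow _
  · rw [CutFEM.ImmersedDomain.massMatrix_eq_toMatrix,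
      CutFEM.ImmersedDomain.meshMassMatrix_eq_toMatrix,
      LinearMap.BilinForm.dotProduct_toMatrix_mulVec,
      LinearMap.BilinForm.dotProduct_toMatrix_mulVec]
    exact hup _
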